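/- All digraphs are finite and may have multiple arcs but no loops. Let $D=(V+x,A)$ be a digraph with vertex set $V+x=V\cup\{x\}$, where $x\notin V$, and arc set $A$. An $x$-arborescence in $D$ is a (not necessarily spanning) subdigraph $F$ of $D$ that contains $x$, whose underlying graph is a tree, and in which every $u\in V(F)$ is reached from $x$ by exactly one directed path of $F$. A subdigraph is identified with its arc set where convenient. For $B\subseteq A$, $X\subseteq V$ and $u\in V$, let $d^-_B(X)$ be the number of arcs of $B$ with head in $X$ and tail not in $X$, let $[x,u]_B$ be the number of arcs of $B$ from $x$ to $u$, and let $d^+_F(x)$ be the number of arcs of $F$ with tail $x$; $E^+(x)$ is the set of arcs of $A$ with tail $x$, and $N^+(x)$ is the set of their heads. Let $k>0$ be an integer, let $\{I_1,\dots,I_l\}$ be a partition of $[k]=\{1,\dots,k\}$ into nonempty parts, and let $c_1,\dots,c_l,c'_1,\dots,c'_l$ be nonnegative integers with $c_\alpha\le c'_\alpha$ for $1\le\alpha\le l$. Let $F_1,\dots,F_k$ be pairwise arc-disjoint $x$-arborescences in $D$ with $\sum_{i\in I_\alpha}d^+_{F_i}(x)\le c'_\alpha$ for $1\le\alpha\le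 l$. For $I\subseteq[k]$ write $\overline I=[k]\setminus I$; for $X\subseteq V$ put $P_I(X)=\{i\in I: X\cap V(F_i)=\emptyset\}$; for $u\in V$ put $w_I(u)=\min\{|\{i\in I:u\notin V(F_i)\}|,\ [x,u]_{A\setminus\bigcup_{i=1}^kF_i}\}$ if $u\in N^+(x)$ and $w_I(u)=0$ otherwise; and put $\widetilde w_I(X)=\sum_{u\in X}w_I(u)$. **Theorem.** There exist pairwise arc-disjoint spanning $x$-arborescences $F^*_1,\dots,F^*_k$ in $D$ such that $F_i$ is a subdigraph of $F^*_i$ for $1\le i\le k$ and $$c_\alpha\le\sum_{i\in I_\alpha}d^+_{F^*_i}(x)\le c'_\alpha\qquad(1\le\alpha\le l)$$ if and only if, for every $t\ge 0$, all pairwise disjoint nonempty sets $X_1,\dots,X_t\subseteq V$, and every $I\subseteq[k]$ that is the union of some (possibly none) of $I_1,\dots,I_l$, both of the following hold: (i) $\displaystyle\sum_{j=1}^{t}d^-_{A\setminus\bigcup_{i=1}^kF_i}(X_j)\ \ge\ \sum_{j=1}^{t}|P_I(X_j)|+\sum_{I_\alpha\subseteq\overline I}\Bigl(c_\alpha-\sum_{i\in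 I_\alpha}d^+_{F_i}(x)\Bigr)-\widetilde w_{\overline I}\Bigl(V\setminus\bigcup_{j=1}^{t}X_j\Bigr);$ (ii) $\displaystyle\sum_{j=1}^{t}\Bigl(|P_I(X_j)|-d^-_{A\setminus(\bigcup_{i=1}^kF_i\,\cup\,E^+(x))}(X_j)\Bigr)\ \le\ \sum_{I_\alpha\subseteq I}\Bigl(c'_\alpha-\sum_{i\in I_\alpha}d^+_{F_i}(x)\Bigr).$ -/

import Mathlib

/-- A digraph with vertex set `W` and arc set `A`; multiple arcs are allowed, loops are not. -/
structure MultiDigraph (W A : Type*) where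
  tail : A → W
  head : A → W
  tail_ne_head : ∀ a, tail a ≠ head a

namespace MultiDigraph

variable {W A : Type*}

/-- A subdigraph: a set of vertices and a set of arcs having both ends among these vertices. -/
structure Sub (D : MultiDigraph W A) where
  verts : Finset W
  arcs : Finset A
  tail_mem : ∀ a ∈ arcs, D.tail a ∈ verts
  head_mem : ∀ a ∈ arcs, D.head a ∈ verts

/-- The sequence of arcs `p` is a directed walk from `r` to `u`. -/
def IsWalk (D : MultiDigraph W A) : W → List A → W → Prop
  | r, [], u => r = u
  | r, a :: p, u => D.tail a = r ∧ D.IsWalk (D.head a) p u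

namespace Sub

variable {D : MultiDigraph W A}

/-- `p` is the arc sequence of a directed path from `r` to `u` in `F`: a directed walk
using arcs of `F` and visiting no vertex twice. -/
def IsPath (F : D.Sub) (r : W) (p : List A) (u : W) : Prop :=
  D.IsWalk r p u ∧ (∀ a ∈ p, a ∈ F.arcs) ∧ (r :: p.map D.head).Nodup

/-- The simple graph on the vertices of `F` obtained by forgetting directions and
multiplicities of arcs. -/
def simpleGraph (F : D.Sub) : SimpleGraph {v // v ∈ F.verts} where
  Adj u v := ∃ a ∈ F.arcs,
    (D.tail a = u ∧ D.head a = v) ∨ (D.tail a = v ∧ D.head a = u)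
  symm := ⟨fun _ _ ⟨a, ha, h⟩ => ⟨a, ha, h.symm⟩⟩
  loopless := ⟨by
    rintro u ⟨a, _, ⟨h₁, h₂⟩ | ⟨h₁, h₂⟩⟩ <;> exact D.tail_ne_head a (h₁.trans h₂.symm)⟩

/-- The underlying undirected multigraph of `F` is a tree: no two distinct arcs have the
same pair of ends (they would form a cycle of length two), and the underlying simple graph
is connected and acyclic. -/
def IsUnderlyingTree (F : D.Sub) : Prop :=
  (∀ a ∈ F.arcs, ∀ b ∈ F.arcs, s(D.tail a, D.head a) = s(D.tail b, D.head b) → a = b) ∧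
    F.simpleGraph.IsTree

/-- `F` is an `r`-arborescence (not necessarily spanning). -/
def IsArborescence (F : D.Sub) (r : W) : Prop :=
  r ∈ F.verts ∧ F.IsUnderlyingTree ∧ ∀ u ∈ F.verts, ∃! p : List A, F.IsPath r p u

/-- `F` contains all vertices of the digraph. -/
def IsSpanning (F : D.Sub) : Prop := ∀ v : W, v ∈ F.verts

/-- `F` is a subdigraph of `G`. -/
def IsSubOf (F G : D.Sub) : Prop := F.verts ⊆ G.verts ∧ F.arcs ⊆ G.arcs

end Sub

section Counting

variable [DecidableEq W]

/-- `[X, Y]` in the arc set `B`: the number of arcs of `B` with tail in `X` and head in `Y`. -/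
def numArcs (D : MultiDigraph W A) (B : Finset A) (X Y : Finset W) : ℕ :=
  (B.filter fun a => D.tail a ∈ X ∧ D.head a ∈ Y).card

/-- The set of arcs of `B` with tail `x`. -/
def outArcs (D : MultiDigraph W A) (B : Finset A) (x : W) : Finset A :=
  B.filter fun a => D.tail a = x

/-- The set of heads of the arcs of `B` with tail `x`. -/
def outNbrs (D : MultiDigraph W A) (B : Finset A) (x : W) : Finset W :=
  (D.outArcs B x).image D.head

variable [Fintype W]

/-- In-degree of the vertex set `X` with respect to the arc set `B`. -/
def inDeg (D : MultiDigraph W A) (B : Finset A) (X : Finset W) : ℕ := D.numArcs B Xᶜ X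

/-- Out-degree of the vertex `x` with respect to the arc set `B`. -/
def outDeg (D : MultiDigraph W A) (B : Finset A) (x : W) : ℕ := D.numArcs B {x} {x}ᶜ

end Counting

section Families

variable [DecidableEq W] [DecidableEq A] {D : MultiDigraph W A} {k : ℕ}

/-- The members of the family are pairwise arc-disjoint. -/
def ArcDisjoint (F : Fin k → D.Sub) : Prop :=
  ∀ i j, i ≠ j → Disjoint (F i).arcs (F j).arcs

/-- `P_I(X)`: the indices `i` in `I` for which `F i` has no vertex in `X`. -/
def missing (F : Fin k → D.Sub) (I : Finset (Fin k)) (X : Finset W) : Finset (Fin k) :=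
  I.filter fun i => Disjoint X (F i).verts

variable [Fintype A]

/-- The arcs of `D` that belong to no member of the family. -/
def freeArcs (F : Fin k → D.Sub) : Finset A :=
  Finset.univ \ Finset.univ.biUnion fun i => (F i).arcs

/-- `w_I(u)`: the minimum of the number of `i` in `I` with `u` not in `F i` and the number of
free arcs from `x` to `u` if `u` is an out-neighbour of `x` in `D`, and `0` otherwise. -/
def weight (F : Fin k → D.Sub) (x : W) (I : Finset (Fin k)) (u : W) : ℕ :=
  if u ∈ D.outNbrs Finset.univ x then
    min (I.filter fun i => u ∉ (F i).verts).card (D.numArcs (freeArcs F) {x} {u})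
  else 0

end Families

end MultiDigraph

/-! Necessity is a count: the arcs added to the given arborescences are free, and every spanning
extension of an `F i` missing `X` adds an arc entering `X`. For sufficiency, the number of new root
arcs from each part to each vertex is decided first, then these arcs are handed to individual
arborescences, then Edmonds' theorem finishes without touching the root.

Let n(u) be the number of free arcs from x to u. The numbers sought form a nonnegative integral
matrix m(α, u), with an extra row `none` for the arcs left unused and with column sums n(u). Two
things are required. For every set S of parts and every X ⊆ V, the entries in S × X must make up for
the free arcs into X, not from x, that are lacking for the members of S missing X (`deficit`). And
m(α, u) may not exceed the number of members of part α missing u; by the column sums this is a lower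
bound on the complementary entries of column u (`surplus`). Both say that m covers one function,
`demand`, supermodular for union of labels and intersection of sets. Given such an m, root arcs can
be added one by one (`exists_root_extension`) until Edmonds' condition holds
(`exists_spanning_extension`).

For a bisupermodular p, a covering matrix with row sums a and column sums b exists once a(S)
dominates every packing by disjoint sets with labels inside S, b(v) ≤ p(univ, {v}), and the totals
agree (`exists_covering_matrix`). The matrix is built one unit at a time; the crux,
`exists_unblocked`, is that for each column u with b(u) > 0 some row can take a unit. Suitable row
sums between the prescribed bounds come from `exists_vector_in_box`, and `exists_subpartition` turns
the hypotheses on packings into (i) and (ii). -/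

set_option linter.unusedSectionVars false

/-! ### Uncrossing packings of labelled sets -/

section PackingValue

variable {Λ V : Type*} [DecidableEq V]

/-- `PackingValue p S U v`: there are pairwise disjoint nonempty subsets `X₁, …, Xₜ` of `U` and
labels `T₁, …, Tₜ ⊆ S` such that `∑ j, p Tⱼ Xⱼ = v`. -/
inductive PackingValue (p : Finset Λ → Finset V → ℤ) (S : Finset Λ) : Finset V → ℤ → Prop
  | nil (U : Finset V) : PackingValue p S U 0
  | cons {U : Finset V} {T : Finset Λ} {X : Finset V} {v : ℤ} (hT : T ⊆ S) (hX : X.Nonempty)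
      (hXU : X ⊆ U) (h : PackingValue p S (U \ X) v) : PackingValue p S U (p T X + v)

variable [DecidableEq Λ]

/-- Supermodularity on pairs `(S, X)`, for the order that is increasing in `S` and decreasing in
`X`, required for pairs whose second components intersect. -/
def IsBisupermodular (p : Finset Λ → Finset V → ℤ) : Prop :=
  ∀ S T X Y, (X ∩ Y).Nonempty → p S X + p T Y ≤ p (S ∪ T) (X ∩ Y) + p (S ∩ T) (X ∪ Y)

namespace PackingValue

variable {p : Finset Λ → Finset V → ℤ} {S S' : Finset Λ} {U U' : Finset V} {v v' : ℤ}

theorem mono (h : PackingValue p S U v) (hS : S ⊆ S') (hU : U ⊆ U') : PackingValue p S' U' v := by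
  induction h generalizing U' with
  | nil U => exact nil _
  | cons hT hX hXU _ ih =>
    exact cons (hT.trans hS) hX (hXU.trans hU) (ih (Finset.sdiff_subset_sdiff hU subset_rfl))

theorem add (h : PackingValue p S U v) (h' : PackingValue p S U' v') (hd : Disjoint U U') :
    PackingValue p S (U ∪ U') (v + v') := by
  induction h with
  | nil U => simpa using h'.mono subset_rfl Finset.subset_union_right
  | @cons U T X v hT hX hXU _ ih =>
    rw [add_assoc]
    refine cons hT hX (hXU.trans Finset.subset_union_left) ?_
    refine (ih (hd.mono_left Finset.sdiff_subset)).mono subset_rfl ?_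
    rw [Finset.disjoint_left] at hd
    grind

theorem single {T : Finset Λ} {X : Finset V} (hT : T ⊆ S) (hX : X.Nonempty) (hXU : X ⊆ U) :
    PackingValue p S U (p T X) := by
  simpa using cons hT hX hXU (nil (p := p) _)

/-- The pair `(T, Y)` is uncrossed successively with the members it meets. Each such member leaves
its trace inside `Y`, with an enlarged label, and the rest of it is swallowed by the growing set
`Z`, whose label shrinks. The first alternative is the case where `Y` meets no member. -/
theorem absorb (hp : IsBisupermodular p) (h : PackingValue p S U v) (T : Finset Λ)
    {Y : Finset V} (hY : Y.Nonempty) :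
    PackingValue p S (U \ Y) v ∨ ∃ T' Z w₁ w₂, T' ⊆ S ∩ T ∧ Y ⊆ Z ∧ Z ⊆ U ∪ Y ∧
      PackingValue p (S ∪ T) (U ∩ Y) w₁ ∧ PackingValue p S (U \ Z) w₂ ∧
      v + p T Y ≤ w₁ + w₂ + p T' Z := by
  induction h with
  | nil U => exact Or.inl (nil _)
  | @cons U T₁ X v hT₁ hX hXU h ih =>
    rcases ih with h₁ | ⟨T', Z, w₁, w₂, hT', hYZ, hZ, h₁, h₂, hv⟩
    · rcases (X ∩ Y).eq_empty_or_nonempty with he | hne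
      · refine Or.inl (cons hT₁ hX ?_ (h₁.mono subset_rfl ?_)) <;>
        · have := Finset.disjoint_left.1 (Finset.disjoint_iff_inter_eq_empty.2 he)
          grind
      · refine Or.inr ⟨T₁ ∩ T, X ∪ Y, _, _, by grind, by grind, by grind,
          single (T := T₁ ∪ T) (by grind) hne (by grind), h₁.mono subset_rfl (by grind), ?_⟩
        linarith [hp T₁ T X Y hne]
    · rcases (X ∩ Z).eq_empty_or_nonempty with he | hne
      · have := Finset.disjoint_left.1 (Finset.disjoint_iff_inter_eq_empty.2 he)
        exact Or.inr ⟨T', Z, w₁, p T₁ X + w₂, hT', hYZ, by grind, h₁.mono subset_rfl (by grind),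
          cons hT₁ hX (by grind) (h₂.mono subset_rfl (by grind)), by linarith⟩
      -- `Z` has so far grown only inside `U \ X`.
      · have hXZ : X ∩ Z = X ∩ Y := by grind
        have := hp T₁ T' X Z hne
        rw [hXZ] at this hne
        exact Or.inr ⟨T₁ ∩ T', X ∪ Z, p (T₁ ∪ T') (X ∩ Y) + w₁, w₂, by grind, by grind, by grind,
          cons (by grind) hne (by grind) (h₁.mono subset_rfl (by grind)),
          h₂.mono subset_rfl (by grind), by linarith⟩

theorem absorb_of_subset (hp : IsBisupermodular p) (h : PackingValue p S U v) {T : Finset Λ}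
    (hT : T ⊆ S) {Y : Finset V} (hY : Y.Nonempty) :
    ∃ T' Z w₁ w₂, T' ⊆ T ∧ Y ⊆ Z ∧ Z ⊆ U ∪ Y ∧ PackingValue p S (U ∩ Y) w₁ ∧
      PackingValue p S (U \ Z) w₂ ∧ v + p T Y ≤ w₁ + w₂ + p T' Z := by
  rcases h.absorb hp T hY with h₁ | ⟨T', Z, w₁, w₂, hT', hYZ, hZ, h₁, h₂, hv⟩
  · exact ⟨T, Y, 0, v, subset_rfl, subset_rfl, Finset.subset_union_right, nil _, h₁, by linarith⟩
  · exact ⟨T', Z, w₁, w₂, by grind, hYZ, hZ, h₁.mono (by grind) subset_rfl, h₂, hv⟩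

theorem insert_sdiff {Z : Finset V} {T : Finset Λ} (h : PackingValue p S (U \ Z) v) (hT : T ⊆ S)
    (hZ : Z.Nonempty) : PackingValue p S (U ∪ Z) (p T Z + v) :=
  cons hT hZ Finset.subset_union_right (h.mono subset_rfl (by grind))

/-- Uncrossing of a packing with labels in `S`, together with a packing with labels in `S ∩ S'`
outside the first one, and a packing with labels in `S'`. -/
theorem uncross (hp : IsBisupermodular p) {U₂ : Finset V} {v₂ : ℤ}
    (h : PackingValue p S U v) (h₂ : PackingValue p (S ∩ S') U₂ v₂) (hd : Disjoint U U₂)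
    (h' : PackingValue p S' U' v') :
    ∃ w w', PackingValue p (S ∪ S') (U ∪ U') w ∧ PackingValue p (S ∩ S') (U ∪ U₂ ∪ U') w' ∧
      v + v₂ + v' ≤ w + w' := by
  induction h' generalizing U U₂ v v₂ with
  | nil U' =>
    exact ⟨v, v₂, h.mono (by grind) (by grind), h₂.mono subset_rfl (by grind), by simp⟩
  | @cons U' T Y v' hT hY hYU _ ih =>
    have hd' := Finset.disjoint_left.1 hd
    -- after absorbing `(T, Y)`, recurse and put back the pieces inside `Y`
    have finish : ∀ (U₃ U₄ : Finset V) (w₁ w₃ w₄ : ℤ), Disjoint U₃ U₄ → U₃ ⊆ U \ Y →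
        U₄ ⊆ U ∪ U₂ ∪ Y →
        PackingValue p S U₃ w₃ → PackingValue p (S ∩ S') U₄ w₄ →
        PackingValue p (S ∪ S') Y w₁ → v + v₂ + p T Y ≤ w₁ + w₃ + w₄ →
        ∃ w w', PackingValue p (S ∪ S') (U ∪ U') w ∧ PackingValue p (S ∩ S') (U ∪ U₂ ∪ U') w' ∧
          v + v₂ + (p T Y + v') ≤ w + w' := by
      intro U₃ U₄ w₁ w₃ w₄ hd₃ h₃ h₄ hw₃ hw₄ hw₁ hle
      obtain ⟨w, w', hw, hw', hle'⟩ := ih hw₃ hw₄ hd₃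
      refine ⟨w₁ + w, w', (hw₁.add hw ?_).mono subset_rfl ?_, hw'.mono subset_rfl ?_, by linarith⟩
      · rw [Finset.disjoint_left]; grind
      · grind
      · grind
    -- A union produced here has its label in `S ∩ S'`, so it moves to the second packing, where it
    -- is absorbed in turn.
    rcases h.absorb hp T hY with h₁ | ⟨T', Z, w₁, w₃, hT', hYZ, hZ, h₁, h₃, hv⟩
    · rcases h₂.absorb hp T hY with h₄ | ⟨T', Z, w₁, w₄, hT', hYZ, hZ, h₁', h₄, hv⟩
      · exact finish (U \ Y) (U₂ \ Y) (p T Y) v v₂ (by rw [Finset.disjoint_left]; grind) subset_rfl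
          (by grind) h₁ h₄ (single (by grind) hY subset_rfl) (by linarith)
      · exact finish (U \ Y) (U₂ ∪ Z) w₁ v (p T' Z + w₄) (by rw [Finset.disjoint_left]; grind)
          subset_rfl (by grind) h₁ (h₄.insert_sdiff (by grind) (hY.mono hYZ))
          (h₁'.mono (by grind) (by grind)) (by linarith)
    · obtain ⟨T'', Z', w₁', w₄, hT'', hZZ', hZ', h₁', h₄, hv'⟩ :=
        h₂.absorb_of_subset hp (T := T') (by grind) (hY.mono hYZ)
      refine finish (U \ Z) (U₂ ∪ Z') (w₁ + w₁') w₃ (p T'' Z' + w₄)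
        (by rw [Finset.disjoint_left]; grind) (by grind) (by grind) h₃
        (h₄.insert_sdiff (by grind) (hY.mono (hYZ.trans hZZ')))
        (((h₁.mono (S' := S ∪ S') (by grind) subset_rfl).add
          (h₁'.mono (by grind) subset_rfl) ?_).mono subset_rfl ?_) (by linarith)
      · rw [Finset.disjoint_left]; grind
      · grind

/-- If `q` and `p` agree on sets avoiding `u`, a packing for `q` either avoids `u` or has exactly
one member containing `u`. -/
theorem split_at {q : Finset Λ → Finset V → ℤ} {u : V} (hq : ∀ T X, u ∉ X → q T X = p T X)
    (h : PackingValue q S U v) :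
    PackingValue p S (U.erase u) v ∨
      ∃ T X v₀, T ⊆ S ∧ X ⊆ U ∧ u ∈ X ∧ PackingValue p S (U \ X) v₀ ∧ v = q T X + v₀ := by
  have avoid : ∀ {U v}, PackingValue q S U v → u ∉ U → PackingValue p S U v := by
    intro U v h
    induction h with
    | nil U => exact fun _ => nil _
    | cons hT hX hXU _ ih =>
      intro hu
      rw [hq _ _ fun h => hu (hXU h)]
      exact cons hT hX hXU (ih (by grind))
  induction h with
  | nil U => exact Or.inl (nil _)
  | @cons U T X v hT hX hXU h ih =>
    by_cases hu : u ∈ X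
    · exact Or.inr ⟨T, X, v, hT, hXU, hu, avoid h (by grind), rfl⟩
    · rw [hq _ _ hu]
      rcases ih with h₁ | ⟨T', X', v₀, hT', hX', hu', h₁, rfl⟩
      · exact Or.inl (cons hT hX (by grind) (h₁.mono subset_rfl (by grind)))
      · refine Or.inr ⟨T', X', p T X + v₀, hT', by grind, hu', ?_, by ring⟩
        exact cons hT hX (by grind) (h₁.mono subset_rfl (by grind))

theorem exists_le {q : Finset Λ → Finset V → ℤ} (hq : ∀ T X, q T X ≤ p T X)
    (h : PackingValue q S U v) : ∃ w, v ≤ w ∧ PackingValue p S U w := by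
  induction h with
  | nil U => exact ⟨0, le_rfl, nil _⟩
  | @cons U T X v hT hX hXU _ ih =>
    obtain ⟨w, hw, h⟩ := ih
    exact ⟨p T X + w, add_le_add (hq _ _) hw, cons hT hX hXU h⟩

end PackingValue

/-- Lowering a bisupermodular function by one on the pairs `(T, X)` with `u ∈ X` that do not
satisfy `T ⊆ T₀ ∧ Y₀ ⊆ X` preserves bisupermodularity. -/
theorem IsBisupermodular.penalty {p : Finset Λ → Finset V → ℤ} (hp : IsBisupermodular p) (u : V)
    (T₀ : Finset Λ) (Y₀ : Finset V) :
    IsBisupermodular fun T X => p T X - if u ∈ X ∧ ¬ (T ⊆ T₀ ∧ Y₀ ⊆ X) then 1 else 0 := by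
  intro S T X Y h
  have := hp S T X Y h
  have h₁ : u ∈ X ∩ Y ↔ u ∈ X ∧ u ∈ Y := Finset.mem_inter
  have h₂ : u ∈ X ∪ Y ↔ u ∈ X ∨ u ∈ Y := Finset.mem_union
  have h₃ : S ∪ T ⊆ T₀ ↔ S ⊆ T₀ ∧ T ⊆ T₀ := Finset.union_subset_iff
  have h₄ : Y₀ ⊆ X ∩ Y ↔ Y₀ ⊆ X ∧ Y₀ ⊆ Y := Finset.subset_inter_iff
  have h₅ : S ⊆ T₀ → S ∩ T ⊆ T₀ := Finset.inter_subset_left.trans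
  have h₆ : T ⊆ T₀ → S ∩ T ⊆ T₀ := Finset.inter_subset_right.trans
  have h₇ : Y₀ ⊆ X → Y₀ ⊆ X ∪ Y := fun h => h.trans Finset.subset_union_left
  have h₈ : Y₀ ⊆ Y → Y₀ ⊆ X ∪ Y := fun h => h.trans Finset.subset_union_right
  simp only [h₁, h₂, h₃, h₄]
  grind

theorem IsBisupermodular.sub_indicator {p : Finset Λ → Finset V → ℤ} (hp : IsBisupermodular p)
    (α : Λ) (u : V) :
    IsBisupermodular fun T X => p T X - if α ∈ T ∧ u ∈ X then 1 else 0 := by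
  intro S T X Y h
  have := hp S T X Y h
  simp only [Finset.mem_union, Finset.mem_inter]
  grind

end PackingValue

/-! ### Tight packings and unblocked labels -/

section Tight

variable {Λ V : Type*} [DecidableEq Λ] [DecidableEq V]

/-- A packing of `G` with labels in `S` that has total value at least `a(S)` and in which `X` is the
member containing `u`, with label `T`. -/
def TightAt (p : Finset Λ → Finset V → ℤ) (G : Finset V) (a : Λ → ℤ) (u : V)
    (S T : Finset Λ) (X : Finset V) : Prop :=
  T ⊆ S ∧ X ⊆ G ∧ u ∈ X ∧ ∃ v, PackingValue p S (G \ X) v ∧ ∑ α ∈ S, a α ≤ p T X + v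

/-- A packing with labels in `S` that avoids `u` and has total value at least `a(S)`. -/
def TightAvoiding (p : Finset Λ → Finset V → ℤ) (G : Finset V) (a : Λ → ℤ) (u : V)
    (S : Finset Λ) : Prop :=
  ∃ v, PackingValue p S (G.erase u) v ∧ ∑ α ∈ S, a α ≤ v

variable {p : Finset Λ → Finset V → ℤ} {G : Finset V} {a : Λ → ℤ} {u : V}

/-- The members at `u` are uncrossed with each other, then the rest of the two packings. Since `a`
dominates all packings and is modular, both results are tight. Nothing in the uncrossing itself says
that the member of the meet at `u` has label inside `T ∩ T'` and contains `X ∪ X'`; a unit penalty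
on the other pairs at `u` enforces this. -/
theorem TightAt.join_meet (hp : IsBisupermodular p)
    (ha : ∀ S v, PackingValue p S G v → v ≤ ∑ α ∈ S, a α) {S T S' T' : Finset Λ} {X X' : Finset V}
    (h : TightAt p G a u S T X) (h' : TightAt p G a u S' T' X') :
    TightAt p G a u (S ∪ S') (T ∪ T') (X ∩ X') ∧
      (¬ TightAvoiding p G a u (S ∩ S') →
        ∃ T₀ Z, T₀ ⊆ T ∩ T' ∧ X ∪ X' ⊆ Z ∧ TightAt p G a u (S ∩ S') T₀ Z) := by
  obtain ⟨hT, hX, hu, v, hv, hle⟩ := h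
  obtain ⟨hT', hX', hu', v', hv', hle'⟩ := h'
  set q : Finset Λ → Finset V → ℤ :=
    fun R Y => p R Y - if u ∈ Y ∧ ¬ (R ⊆ T ∩ T' ∧ X ∪ X' ⊆ Y) then 1 else 0 with hq_def
  have hq : IsBisupermodular q := hp.penalty u _ _
  have hqp : ∀ R Y, u ∉ Y → q R Y = p R Y := fun R Y hY => by simp [hq_def, hY]
  have hqp' : ∀ R Y, R ⊆ T ∩ T' → X ∪ X' ⊆ Y → q R Y = p R Y := fun R Y h₁ h₂ => by
    simp only [hq_def, h₁, h₂, and_self, not_true_eq_false, and_false, if_false, sub_zero]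
  have hql : ∀ R Y, q R Y ≤ p R Y := fun R Y => by
    simp only [hq_def]; split_ifs <;> linarith
  have lift : ∀ {R U w}, u ∉ U → PackingValue q R U w → PackingValue p R U w := by
    intro R U w hU hw
    rcases hw.split_at hqp with h₁ | ⟨_, _, _, _, h₂, h₃, _⟩
    · exact h₁.mono subset_rfl (Finset.erase_subset _ _)
    · exact absurd (h₂ h₃) hU
  have lower : ∀ {R U w}, u ∉ U → PackingValue p R U w → PackingValue q R U w := by
    intro R U w hU hw
    rcases hw.split_at (q := p) (p := q) (fun R Y hY => (hqp R Y hY).symm) with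
      h₁ | ⟨_, _, _, _, h₂, h₃, _⟩
    · exact h₁.mono subset_rfl (Finset.erase_subset _ _)
    · exact absurd (h₂ h₃) hU
  have hne : (X ∪ X').Nonempty := ⟨u, by grind⟩
  obtain ⟨T₁, Z, w₁, w₂, hT₁, hXZ, hZ, hw₁, hw₂, hle₁⟩ :=
    (lower (by grind) hv).absorb_of_subset hq (T := T ∩ T') (Y := X ∪ X')
      (Finset.inter_subset_left.trans hT) hne
  obtain ⟨w, w', hw, hw', hle₂⟩ := PackingValue.uncross hq (S := S) (S' := S') (U := G \ Z)
    (U₂ := Z) (v₂ := q T₁ Z) (hw₂.mono subset_rfl (by grind))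
    (PackingValue.single (by grind) (hne.mono hXZ) subset_rfl)
    Finset.sdiff_disjoint (lower (by grind) hv')
  have hZG : Z ⊆ G := by grind
  have hbi := hp T T' X X' ⟨u, by grind⟩
  rw [hqp' _ _ subset_rfl subset_rfl] at hle₁
  have hsum := Finset.sum_union_inter (s₁ := S) (s₂ := S') (f := a)
  have hjoin : PackingValue p (S ∪ S') (G \ (X ∩ X')) (w₁ + w) := by
    refine ((lift (by grind) (hw₁.mono (S' := S ∪ S') (by grind) subset_rfl)).add
      (lift (by grind) hw) ?_).mono subset_rfl ?_
    · rw [Finset.disjoint_left]; grind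
    · grind
  have hmeet : PackingValue q (S ∩ S') G w' := hw'.mono subset_rfl (by grind)
  refine ⟨⟨by grind, by grind, by grind, _, hjoin, ?_⟩, fun hna => ?_⟩
  · obtain ⟨w'', hle₃, hw''⟩ := hmeet.exists_le hql
    have := ha _ _ hw''
    linarith
  · have hle₃ := ha _ _ (PackingValue.cons (T := T ∪ T') (by grind)
      (⟨u, by grind⟩ : (X ∩ X').Nonempty) (by grind) hjoin)
    rcases hmeet.split_at hqp with h₁ | ⟨T₀, Y, v₀, hT₀, hY, huY, h₁, rfl⟩
    · exact absurd ⟨w', h₁, by linarith⟩ hna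
    · have hle₄ := ha _ _ (PackingValue.cons hT₀ ⟨u, huY⟩ hY h₁)
      -- The packing is tight already for `q`; a penalized member would make its value under `p`
      -- exceed the bound by one.
      by_cases hc : T₀ ⊆ T ∩ T' ∧ X ∪ X' ⊆ Y
      · rw [hqp' _ _ hc.1 hc.2] at hle₂
        exact ⟨T₀, Y, hc.1, hc.2, hT₀, hY, huY, v₀, h₁, by linarith⟩
      · have : q T₀ Y = p T₀ Y - 1 := by simp only [hq_def, huY, hc]; simp
        linarith

theorem TightAvoiding.union (hp : IsBisupermodular p)
    (ha : ∀ S v, PackingValue p S G v → v ≤ ∑ α ∈ S, a α) {S S' : Finset Λ}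
    (h : TightAvoiding p G a u S) (h' : TightAvoiding p G a u S') :
    TightAvoiding p G a u (S ∪ S') := by
  obtain ⟨v, hv, hle⟩ := h
  obtain ⟨v', hv', hle'⟩ := h'
  obtain ⟨w, w', hw, hw', hle₂⟩ := PackingValue.uncross hp hv (.nil ∅) (by simp) hv'
  have := ha _ _ (hw'.mono subset_rfl (by grind))
  have hsum := Finset.sum_union_inter (s₁ := S) (s₂ := S') (f := a)
  exact ⟨w, hw.mono subset_rfl (by grind), by linarith⟩

/-- If the member at `u` meets the packing for `R`, uncrossing leaves only traces that avoid `u` in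
the union. Otherwise the member survives unchanged, and the packing for `R` lies outside it. -/
theorem TightAt.union_avoiding (hp : IsBisupermodular p)
    (ha : ∀ S v, PackingValue p S G v → v ≤ ∑ α ∈ S, a α) {S T R : Finset Λ} {X : Finset V}
    (h : TightAt p G a u S T X) (hR : TightAvoiding p G a u R) :
    TightAvoiding p G a u (R ∪ S) ∨
      TightAt p G a u (R ∪ S) T X ∧ ∃ v, PackingValue p R (G \ X) v ∧ ∑ α ∈ R, a α ≤ v := by
  obtain ⟨hT, hX, hu, v, hv, hle⟩ := h
  obtain ⟨v', hv', hle'⟩ := hR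
  have hsum := Finset.sum_union_inter (s₁ := R) (s₂ := S) (f := a)
  rcases hv'.absorb hp T ⟨u, hu⟩ with h₁ | ⟨T', Z, w₁, w₂, hT', hYZ, hZ, h₁, h₂, hvv⟩
  · have h₂ : PackingValue p R (G \ X) v' := h₁.mono subset_rfl (by grind)
    obtain ⟨w, w', hw, hw', hle₂⟩ := PackingValue.uncross hp h₂ (.nil ∅) (by simp) hv
    have := ha _ _ (hw'.mono subset_rfl (by grind))
    exact Or.inr ⟨⟨by grind, hX, hu, w, hw.mono subset_rfl (by grind), by linarith⟩, v', h₂, hle'⟩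
  · obtain ⟨w, w', hw, hw', hle₂⟩ := PackingValue.uncross hp h₂
      (PackingValue.single (p := p) (S := R ∩ S) (T := T') (X := Z) (U := Z) (by grind)
        ⟨u, hYZ hu⟩ subset_rfl) (by rw [Finset.disjoint_left]; grind) hv
    have := ha _ _ (hw'.mono subset_rfl (by grind))
    refine Or.inl ⟨w₁ + w, ((h₁.mono (S' := R ∪ S) (by grind) subset_rfl).add hw ?_).mono
      subset_rfl ?_, by linarith⟩
    · rw [Finset.disjoint_left]; grind
    · grind

theorem exists_maximal_tightAvoiding [Fintype Λ] (hp : IsBisupermodular p)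
    (ha : ∀ S v, PackingValue p S G v → v ≤ ∑ α ∈ S, a α) (u : V) :
    ∃ R, TightAvoiding p G a u R ∧ ∀ S, TightAvoiding p G a u S → S ⊆ R := by
  classical
  obtain ⟨R, hR, hmax⟩ := Finset.exists_max_image
    (Finset.univ.filter fun S => TightAvoiding p G a u S) Finset.card
    ⟨∅, by simpa using ⟨0, PackingValue.nil _, by simp⟩⟩
  simp only [Finset.mem_filter, Finset.mem_univ, true_and] at hR hmax
  refine ⟨R, hR, fun S hS => ?_⟩
  have h := Finset.eq_of_subset_of_card_le Finset.subset_union_left (hmax _ (hR.union hp ha hS))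
  rw [h]
  exact Finset.subset_union_right

/-- Some label `α` is not blocked at `u`: every tight packing with labels in `S ∋ α` has a member
that contains `u` and whose label contains `α`. -/
theorem exists_unblocked [Fintype Λ] (hp : IsBisupermodular p)
    (ha : ∀ S v, PackingValue p S G v → v ≤ ∑ α ∈ S, a α) (b : V → ℕ)
    (hb : ∀ v ∈ G, (b v : ℤ) ≤ p Finset.univ {v}) (hab : ∑ α, a α = ∑ v ∈ G, (b v : ℤ))
    (hu : u ∈ G) (hbu : 0 < b u) :
    ∃ α, (∀ S, TightAvoiding p G a u S → α ∉ S) ∧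
      ∀ S T X, TightAt p G a u S T X → α ∈ S → α ∈ T := by
  classical
  obtain ⟨R, hR, hmax⟩ := exists_maximal_tightAvoiding hp ha u
  by_contra hcon
  push Not at hcon
  have hpack : ∀ U ⊆ G, ∃ v, PackingValue p Finset.univ U v ∧ ∑ v ∈ U, (b v : ℤ) ≤ v := by
    intro U
    induction U using Finset.induction_on with
    | empty => exact fun _ => ⟨0, .nil _, by simp⟩
    | insert z U hz ih =>
      intro hU
      obtain ⟨v, hv, hle⟩ := ih (by grind)
      refine ⟨p Finset.univ {z} + v, .cons subset_rfl ⟨z, by simp⟩ (by grind)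
        (hv.mono subset_rfl (by grind)), ?_⟩
      rw [Finset.sum_insert hz]
      exact add_le_add (hb z (hU (by simp))) hle
  -- blockers of labels outside `R`
  have block : ∀ α ∉ R, ∃ S T X, R ⊆ S ∧ TightAt p G a u S T X ∧ α ∈ S ∧ α ∉ T := by
    intro α hα
    obtain ⟨S, T, X, hS, hαS, hαT⟩ := hcon α fun S hS h => hα (hmax S hS h)
    rcases hS.union_avoiding hp ha hR with h₁ | ⟨h₁, -⟩
    · exact absurd (hmax _ h₁ (by grind)) hα
    · exact ⟨R ∪ S, T, X, by grind, h₁, by grind, hαT⟩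
  -- If every label is blocked, the member at `u` of a tight packing whose label set properly
  -- contains `R` is worthless. Applied to the packing of `G` by singletons, this contradicts `0 < b
  -- u`.
  have key : ∀ n, ∀ S T X, S.card + T.card = n → R ⊆ S → S ≠ R → TightAt p G a u S T X →
      p T X ≤ 0 := by
    intro n
    induction n using Nat.strong_induction_on with
    | _ n ih =>
    intro S T X hn hRS hne hC
    have hnav : ¬ TightAvoiding p G a u S := fun h => hne ((hmax _ h).antisymm hRS)
    rcases hC.union_avoiding hp ha hR with h₁ | ⟨-, v, hv, hle⟩
    · rw [Finset.union_eq_right.2 hRS] at h₁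
      exact absurd h₁ hnav
    have hCs := hC
    obtain ⟨hTS, hXG, huX, -⟩ := hCs
    -- In this case `(T, X)` can be added to the tight packing for `R` lying outside `X`, so its
    -- value is at most zero.
    by_cases hTR : T ⊆ R
    · have := ha _ _ (PackingValue.cons hTR ⟨u, huX⟩ hXG hv)
      linarith
    -- meets of blockers with `(S, T)`
    have below : ∀ α ∈ T, α ∉ R → ∃ S' T' X', R ⊆ S' ∧ S' ⊆ S ∧ T' ⊆ T ∧ α ∈ S' ∧ α ∉ T' ∧
        TightAt p G a u S' T' X' := by
      intro α hα hαR
      obtain ⟨S', T', X', hRS', h', hαS', hαT'⟩ := block α hαR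
      obtain ⟨T₀, Z, hT₀, -, h₀⟩ := (h'.join_meet hp ha hC).2
        fun h => hαR (hmax _ h (by grind))
      exact ⟨S' ∩ S, T₀, Z, by grind, by grind, by grind, by grind, by grind, h₀⟩
    obtain ⟨α, hαT, hαR⟩ := Finset.not_subset.1 hTR
    obtain ⟨S₁, T₁, X₁, hRS₁, hS₁, hT₁, hαS₁, hαT₁, h₁⟩ := below α hαT hαR
    -- a lower cover of `(S, T)`
    obtain ⟨⟨S₂, T₂⟩, h₂, hmax₂⟩ := Finset.exists_max_image
      (Finset.univ.filter fun D : Finset Λ × Finset Λ => R ⊆ D.1 ∧ D.1 ⊆ S ∧ D.2 ⊆ T ∧ D.1 ≠ R ∧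
        ¬ (D.1 = S ∧ D.2 = T) ∧ ∃ X', TightAt p G a u D.1 D.2 X') (fun D => D.1.card + D.2.card)
      ⟨(S₁, T₁), by
        simp only [Finset.mem_filter, Finset.mem_univ, true_and]
        exact ⟨hRS₁, hS₁, hT₁, by grind, by grind, X₁, h₁⟩⟩
    simp only [Finset.mem_filter, Finset.mem_univ, true_and, Prod.forall] at h₂ hmax₂
    obtain ⟨hRS₂, hS₂, hT₂, hne₂, hne₂', X₂, h₂⟩ := h₂
    -- A label `β` in `T` but not in `S₂` has a blocker below `(S, T)`; its join with `(S₂, T₂)` is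
    -- strictly larger and still not `(S, T)`, as `β` lies in neither `T₂` nor `T₃`.
    have hTS₂ : T ⊆ S₂ := by
      intro β hβ
      by_contra hβS₂
      obtain ⟨S₃, T₃, X₃, hRS₃, hS₃, hT₃, hβS₃, hβT₃, h₃⟩ := below β hβ (by grind)
      have hT₂S₂ := h₂.1
      have := hmax₂ (S₂ ∪ S₃) (T₂ ∪ T₃) ⟨by grind, by grind, by grind, by grind, by grind, _,
        (h₂.join_meet hp ha h₃).1⟩
      have hlt : S₂.card < (S₂ ∪ S₃).card := Finset.card_lt_card ⟨by grind, by grind⟩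
      have hle' : T₂.card ≤ (T₂ ∪ T₃).card := Finset.card_le_card (by grind)
      omega
    have hnav₂ : ¬ TightAvoiding p G a u (S₂ ∩ S) := by
      rw [Finset.inter_eq_left.2 hS₂]
      exact fun h => hne₂ ((hmax _ h).antisymm hRS₂)
    obtain ⟨T₀, Z, hT₀, hZ, h₀⟩ := (h₂.join_meet hp ha hC).2 hnav₂
    rw [Finset.inter_eq_left.2 hS₂] at h₀
    have hcard : S₂.card + T₀.card < n := by
      have h₄ : S₂.card ≤ S.card := Finset.card_le_card hS₂
      have h₅ : T₂.card ≤ T.card := Finset.card_le_card hT₂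
      have h₆ : T₀.card ≤ T₂.card := Finset.card_le_card (by grind)
      have h₇ : S₂.card = S.card → S₂ = S := fun h => Finset.eq_of_subset_of_card_le hS₂ h.ge
      have h₈ : T₂.card = T.card → T₂ = T := fun h => Finset.eq_of_subset_of_card_le hT₂ h.ge
      by_contra hlt
      exact hne₂' ⟨h₇ (by omega), h₈ (by omega)⟩
    have hle₀ := ih _ hcard S₂ T₀ Z rfl hRS₂ hne₂ h₀
    -- As the member `Z ⊇ X` is worthless, the remaining members already reach `a(S₂)`; adding `(T,
    -- X)`, allowed because `T ⊆ S₂`, cannot gain anything.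
    obtain ⟨-, -, -, v₀, hv₀, hle₁⟩ := h₀
    have := ha _ _ (PackingValue.cons hTS₂ ⟨u, huX⟩ hXG (hv₀.mono subset_rfl (by grind)))
    linarith
  have hRuniv : (Finset.univ : Finset Λ) ≠ R := by
    rintro rfl
    obtain ⟨v, hv, hle⟩ := hR
    have := ha _ _ (.cons subset_rfl ⟨u, by simp⟩ (Finset.singleton_subset_iff.2 hu)
      (hv.mono subset_rfl (by grind)))
    have := hb u hu
    omega
  obtain ⟨v, hv, hle⟩ := hpack (G.erase u) (Finset.erase_subset _ _)
  have hsum := Finset.add_sum_erase G (fun v => (b v : ℤ)) hu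
  have := key _ Finset.univ Finset.univ {u} rfl (Finset.subset_univ _) hRuniv
    ⟨subset_rfl, by simpa using hu, by simp, v, hv.mono subset_rfl (by grind), by
      have := hb u hu
      linarith⟩
  have := hb u hu
  omega

end Tight

/-! ### Covering matrices and admissible row sums -/

section DegreeSpecified

variable {Λ V : Type*} [DecidableEq Λ] [DecidableEq V] [Fintype Λ]

/-- Covering a bisupermodular function by a nonnegative integral matrix with prescribed row and
column sums. -/
theorem exists_covering_matrix (G : Finset V) :
    ∀ (n : ℕ) (p : Finset Λ → Finset V → ℤ), IsBisupermodular p → ∀ (a : Λ → ℤ) (b : V → ℕ),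
      (∀ S v, PackingValue p S G v → v ≤ ∑ α ∈ S, a α) →
      (∀ v ∈ G, (b v : ℤ) ≤ p Finset.univ {v}) → ∑ α, a α = ∑ v ∈ G, (b v : ℤ) →
      ∑ v ∈ G, b v = n →
      ∃ m : Λ → V → ℕ, (∀ α, ∑ v ∈ G, (m α v : ℤ) = a α) ∧ (∀ v ∈ G, ∑ α, m α v = b v) ∧
        ∀ S, ∀ X ⊆ G, X.Nonempty → p S X ≤ ∑ α ∈ S, ∑ v ∈ X, (m α v : ℤ) := by
  intro n
  induction n with
  | zero =>
    intro p hp a b ha hb hab hn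
    have hb0 : ∀ v ∈ G, b v = 0 := by simpa using hn
    have ha0 : ∀ α, 0 ≤ a α := fun α => by simpa using ha {α} 0 (.nil _)
    have hsum : ∑ α, a α = 0 := by rw [hab]; exact_mod_cast hn
    have ha' : ∀ α, a α = 0 := fun α =>
      (Finset.sum_eq_zero_iff_of_nonneg fun α _ => ha0 α).1 hsum α (Finset.mem_univ α)
    refine ⟨fun _ _ => 0, by simp [ha'], fun v hv => by simp [hb0 v hv], fun S X hX hne => ?_⟩
    simpa [ha'] using ha S _ (.single subset_rfl hne hX)
  | succ n ih =>
    intro p hp a b ha hb hab hn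
    obtain ⟨u, hu, hbu⟩ : ∃ u ∈ G, 0 < b u := by
      by_contra! h
      have := Finset.sum_nonpos h
      omega
    obtain ⟨α, hα₁, hα₂⟩ := exists_unblocked hp ha b hb hab hu hbu
    have hsumα : ∀ S : Finset Λ, ∑ β ∈ S, (a β - if β = α then 1 else 0) =
        ∑ β ∈ S, a β - if α ∈ S then 1 else 0 := fun S => by
      rw [Finset.sum_sub_distrib, Finset.sum_ite_eq']
    have hbu' : ∀ v, ((b v - if v = u then 1 else 0 : ℕ) : ℤ) = b v - if v = u then 1 else 0 := by
      intro v
      split_ifs with h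
      · subst h; push_cast [Nat.one_le_iff_ne_zero.2 hbu.ne']; rfl
      · simp
    have hsumb : ∑ v ∈ G, ((b v - if v = u then 1 else 0 : ℕ) : ℤ) = ∑ v ∈ G, (b v : ℤ) - 1 := by
      simp only [hbu']
      rw [Finset.sum_sub_distrib, Finset.sum_ite_eq', if_pos hu]
    have hih := ih _ (hp.sub_indicator α u)
      (fun β => a β - if β = α then 1 else 0) (fun v => b v - if v = u then 1 else 0)
      ?_ ?_ ?_ ?_
    · obtain ⟨m, hm₁, hm₂, hm₃⟩ := hih
      refine ⟨fun β v => m β v + if β = α ∧ v = u then 1 else 0, fun β => ?_, fun v hv => ?_,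
        fun S X hX hne => ?_⟩
      · push_cast
        rw [Finset.sum_add_distrib, hm₁]
        by_cases h : β = α <;> simp [h, hu]
      · rw [Finset.sum_add_distrib, hm₂ v hv]
        by_cases h : v = u
        · subst h; simp; omega
        · simp [h]
      · have h₁ := hm₃ S X hX hne
        have h₂ : ∑ β ∈ S, ∑ v ∈ X, ((m β v + if β = α ∧ v = u then 1 else 0 : ℕ) : ℤ) =
            ∑ β ∈ S, ∑ v ∈ X, (m β v : ℤ) + if α ∈ S ∧ u ∈ X then 1 else 0 := by
          push_cast
          simp only [Finset.sum_add_distrib, add_right_inj]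
          simp only [ite_and, Finset.sum_ite_eq', Finset.sum_ite_irrel, Finset.sum_const_zero]
        rw [h₂]
        linarith
    · intro S v hv
      rw [hsumα]
      -- The bound for `S` drops only if `α ∈ S`. A tight packing then loses a unit as well, through
      -- its member at `u`, exactly because `α` is unblocked.
      rcases hv.split_at (p := p) (u := u) (fun T X h => by simp [h]) with
        h₁ | ⟨T, X, v₀, hT, hX, huX, h₁, rfl⟩
      · have := ha _ _ (h₁.mono subset_rfl (Finset.erase_subset _ _))
        split_ifs with h
        · by_contra hlt
          exact hα₁ S ⟨v, h₁, by linarith⟩ h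
        · linarith
      · have := ha _ _ (PackingValue.cons hT ⟨u, huX⟩ hX h₁)
        by_cases hαS : α ∈ S
        · by_cases hαT : α ∈ T
          · simp only [hαS, hαT, huX, and_self, if_true]; linarith
          · simp only [hαS, hαT, false_and, if_true, if_false]
            by_contra hlt
            exact hαT (hα₂ S T X ⟨hT, hX, huX, v₀, h₁, by linarith⟩ hαS)
        · have hαT : α ∉ T := fun h => hαS (hT h)
          simp only [hαS, hαT, false_and, if_false]; linarith
    · intro v hv
      have := hb v hv
      simp only [hbu', Finset.mem_univ, Finset.mem_singleton, true_and]
      grind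
    · rw [hsumα, hsumb, hab]; simp
    · have : ((∑ v ∈ G, (b v - if v = u then 1 else 0) : ℕ) : ℤ) = n := by
        push_cast only [Nat.cast_sum]
        rw [hsumb]
        have : ((∑ v ∈ G, b v : ℕ) : ℤ) = n + 1 := by rw [hn]; push_cast; rfl
        push_cast at this
        linarith
      exact_mod_cast this

/-- Prescribed bounds on row sums: an integral vector of given total in the box `[lo, hi]` that
dominates all packings. -/
theorem exists_vector_in_box {p : Finset Λ → Finset V → ℤ} (hp : IsBisupermodular p)
    (G : Finset V) (lo : Λ → ℤ) (N : ℤ) :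
    ∀ (n : ℕ) (hi : Λ → ℤ), (∀ α, lo α ≤ hi α) → ∑ α, hi α = N + n →
      (∀ S v, PackingValue p S G v → v ≤ ∑ α ∈ S, hi α) →
      (∀ S v, PackingValue p S G v → v + ∑ α ∈ Sᶜ, lo α ≤ N) →
      ∃ a : Λ → ℤ, (∀ α, lo α ≤ a α ∧ a α ≤ hi α) ∧ ∑ α, a α = N ∧
        ∀ S v, PackingValue p S G v → v ≤ ∑ α ∈ S, a α := by
  intro n
  induction n with
  | zero =>
    intro hi hle hN hhi _
    exact ⟨hi, fun α => ⟨hle α, le_rfl⟩, by simpa using hN, hhi⟩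
  | succ n ih =>
    intro hi hle hN hhi hlo
    -- Tight label sets are closed under union. If no coordinate could be lowered, `hi` would equal
    -- `lo` outside the largest tight set `R`, and the lower-bound hypothesis for `R` would give
    -- total at most `N` instead of `N + n + 1`.
    obtain ⟨α, hα, hαS⟩ : ∃ α, lo α < hi α ∧
        ∀ S v, PackingValue p S G v → ∑ β ∈ S, hi β ≤ v → α ∉ S := by
      by_contra! hcon
      classical
      obtain ⟨R, hR, hmax⟩ := Finset.exists_max_image (Finset.univ.filter fun S : Finset Λ =>
          ∃ v, PackingValue p S G v ∧ ∑ β ∈ S, hi β ≤ v) Finset.card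
        ⟨∅, by simpa using ⟨0, .nil _, le_rfl⟩⟩
      simp only [Finset.mem_filter, Finset.mem_univ, true_and] at hR hmax
      obtain ⟨v, hv, hvR⟩ := hR
      have hout : ∀ α ∈ Rᶜ, hi α = lo α := by
        intro α hα
        by_contra hne
        obtain ⟨S, v', hv', hle', hαS⟩ := hcon α (lt_of_le_of_ne (hle α) (Ne.symm hne))
        obtain ⟨w, w', hw, hw', hle₂⟩ := PackingValue.uncross hp hv (.nil ∅) (by simp) hv'
        have := hhi _ _ (hw'.mono subset_rfl (by grind))
        have hsum := Finset.sum_union_inter (s₁ := R) (s₂ := S) (f := hi)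
        have hRS := Finset.eq_of_subset_of_card_le Finset.subset_union_left
          (hmax (R ∪ S) ⟨w, hw.mono subset_rfl (by grind), by linarith⟩)
        rw [Finset.mem_compl, hRS] at hα
        exact hα (Finset.mem_union_right _ hαS)
      have h₁ := hlo _ _ hv
      rw [← Finset.sum_congr rfl hout] at h₁
      have h₂ := Finset.sum_add_sum_compl R hi
      push_cast at hN
      linarith
    have hsumα : ∀ S : Finset Λ, ∑ β ∈ S, (hi β - if β = α then 1 else 0) =
        ∑ β ∈ S, hi β - if α ∈ S then 1 else 0 := fun S => by
      rw [Finset.sum_sub_distrib, Finset.sum_ite_eq']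
    have hih := ih (fun β => hi β - if β = α then 1 else 0) ?_ ?_ ?_ hlo
    · obtain ⟨a, ha₁, ha₂, ha₃⟩ := hih
      refine ⟨a, fun β => ⟨(ha₁ β).1, (ha₁ β).2.trans ?_⟩, ha₂, ha₃⟩
      split_ifs <;> linarith
    · intro β
      have := hle β
      by_cases h : β = α
      · subst h; simp; omega
      · simpa [h] using this
    · rw [hsumα, hN, if_pos (Finset.mem_univ α)]; push_cast; ring
    · intro S v hv
      rw [hsumα]
      have := hhi S v hv
      split_ifs with h
      · by_contra hlt
        exact hαS S v hv (by linarith) h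
      · linarith

end DegreeSpecified

/-! ### Walks, and growing an arborescence by one arc -/

namespace MultiDigraph

variable {W A : Type*} {D : MultiDigraph W A}

theorem isWalk_append {r u : W} {p q : List A} :
    D.IsWalk r (p ++ q) u ↔ ∃ v, D.IsWalk r p v ∧ D.IsWalk v q u := by
  induction p generalizing r with
  | nil => simp [IsWalk]
  | cons a p ih => simp [IsWalk, ih, and_assoc]

/-- A walk from outside `X` into `X` uses an arc entering `X`. -/
theorem IsWalk.exists_entering {r u : W} {p : List A} (h : D.IsWalk r p u) {X : Finset W}
    (hr : r ∉ X) (hu : u ∈ X) : ∃ a ∈ p, D.tail a ∉ X ∧ D.head a ∈ X := by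
  induction p generalizing r with
  | nil => exact absurd (h ▸ hu) hr
  | cons a p ih =>
    obtain ⟨rfl, h⟩ := h
    by_cases ha : D.head a ∈ X
    · exact ⟨a, by simp, hr, ha⟩
    · obtain ⟨b, hb, h'⟩ := ih h ha
      exact ⟨b, by simp [hb], h'⟩

namespace Sub

variable {F : D.Sub}

theorem natCard_edgeSet (h : ∀ a ∈ F.arcs, ∀ b ∈ F.arcs,
    s(D.tail a, D.head a) = s(D.tail b, D.head b) → a = b) :
    Nat.card F.simpleGraph.edgeSet = F.arcs.card := by
  let f : {a // a ∈ F.arcs} → Sym2 {v // v ∈ F.verts} := fun a =>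
    s(⟨D.tail a, F.tail_mem a a.2⟩, ⟨D.head a, F.head_mem a a.2⟩)
  have hf : Function.Injective f := by
    intro a b hab
    refine Subtype.ext (h a a.2 b b.2 ?_)
    simpa [f, Sym2.map_mk] using congrArg (Sym2.map Subtype.val) hab
  have hrange : F.simpleGraph.edgeSet = Set.range f := by
    ext e
    induction e using Sym2.inductionOn with
    | hf u v =>
      simp only [SimpleGraph.mem_edgeSet, Set.mem_range, Subtype.exists, f, simpleGraph, Sym2.eq_iff,
        Subtype.ext_iff, exists_prop]
  rw [hrange, Nat.card_range_of_injective hf, Nat.card_eq_fintype_card, Fintype.card_coe]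

/-- Replacing acyclicity by an edge count makes the effect of a new pendant arc immediate. -/
theorem isUnderlyingTree_iff : F.IsUnderlyingTree ↔
    (∀ a ∈ F.arcs, ∀ b ∈ F.arcs, s(D.tail a, D.head a) = s(D.tail b, D.head b) → a = b) ∧
      F.simpleGraph.Connected ∧ F.arcs.card + 1 = F.verts.card := by
  refine and_congr_right fun h => ?_
  rw [SimpleGraph.isTree_iff_connected_and_card, natCard_edgeSet h, Nat.card_eq_fintype_card,
    Fintype.card_coe]

variable [DecidableEq W] [DecidableEq A]

/-- Adding an arc whose tail is a vertex of `F`. -/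
def addArc (F : D.Sub) (e : A) (he : D.tail e ∈ F.verts) : D.Sub where
  verts := insert (D.head e) F.verts
  arcs := insert e F.arcs
  tail_mem a ha := by
    rcases Finset.mem_insert.1 ha with rfl | ha
    · exact Finset.mem_insert_of_mem he
    · exact Finset.mem_insert_of_mem (F.tail_mem a ha)
  head_mem a ha := by
    rcases Finset.mem_insert.1 ha with rfl | ha
    · exact Finset.mem_insert_self _ _
    · exact Finset.mem_insert_of_mem (F.head_mem a ha)

theorem isSubOf_addArc (F : D.Sub) (e : A) (he : D.tail e ∈ F.verts) :
    F.IsSubOf (F.addArc e he) :=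
  ⟨Finset.subset_insert _ _, Finset.subset_insert _ _⟩

theorem IsPath.mono {G : D.Sub} (hFG : F.IsSubOf G) {r u : W} {p : List A} (h : F.IsPath r p u) :
    G.IsPath r p u :=
  ⟨h.1, fun a ha => hFG.2 (h.2.1 a ha), h.2.2⟩

theorem isUnderlyingTree_addArc (h : F.IsUnderlyingTree) {e : A} (he : D.tail e ∈ F.verts)
    (he' : D.head e ∉ F.verts) : (F.addArc e he).IsUnderlyingTree := by
  rw [isUnderlyingTree_iff] at h ⊢
  obtain ⟨h₁, h₂, h₃⟩ := h
  have hnew : ∀ a ∈ F.arcs, s(D.tail a, D.head a) ≠ s(D.tail e, D.head e) := by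
    intro a ha hae
    have : D.head e ∈ s(D.tail a, D.head a) := hae ▸ Sym2.mem_mk_right _ _
    rcases Sym2.mem_iff.1 this with h | h
    · exact he' (h ▸ F.tail_mem a ha)
    · exact he' (h ▸ F.head_mem a ha)
  refine ⟨?_, ?_, ?_⟩
  · intro a ha b hb hab
    rcases Finset.mem_insert.1 ha with hae | ha' <;> rcases Finset.mem_insert.1 hb with hbe | hb'
    · rw [hae, hbe]
    · exact absurd (hae ▸ hab.symm) (hnew b hb')
    · exact absurd (hbe ▸ hab) (hnew a ha')
    · exact h₁ a ha' b hb' hab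
  · let φ : F.simpleGraph →g (F.addArc e he).simpleGraph :=
      { toFun := fun v => ⟨v, Finset.mem_insert_of_mem v.2⟩
        map_rel' := by
          rintro u v ⟨a, ha, h⟩
          exact ⟨a, Finset.mem_insert_of_mem ha, h⟩ }
    rw [SimpleGraph.connected_iff_exists_forall_reachable]
    refine ⟨⟨D.tail e, Finset.mem_insert_of_mem he⟩, fun v => ?_⟩
    rcases Finset.mem_insert.1 v.2 with hv | hv
    · exact SimpleGraph.Adj.reachable ⟨e, Finset.mem_insert_self _ _, Or.inl ⟨rfl, hv.symm⟩⟩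
    · exact (h₂.preconnected ⟨D.tail e, he⟩ ⟨v, hv⟩).map φ
  · have he'' : e ∉ F.arcs := fun h => he' (F.head_mem e h)
    simp only [addArc]
    rw [Finset.card_insert_of_notMem he', Finset.card_insert_of_notMem he'', h₃]

theorem isPath_addArc_iff_of_mem {e : A} (he : D.tail e ∈ F.verts) (he' : D.head e ∉ F.verts)
    {r u : W} (hu : u ∈ F.verts) {p : List A} :
    (F.addArc e he).IsPath r p u ↔ F.IsPath r p u := by
  refine ⟨fun h => ⟨h.1, fun a ha => ?_, h.2.2⟩, fun h => h.mono (F.isSubOf_addArc e he)⟩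
  -- The new vertex is incident only with `e`, so a walk that uses `e` must end there.
  rcases Finset.mem_insert.1 (h.2.1 a ha) with rfl | h'
  · exfalso
    obtain ⟨p₁, p₂, rfl⟩ := List.append_of_mem ha
    obtain ⟨v, -, -, hw⟩ := isWalk_append.1 h.1
    cases p₂ with
    | nil => exact he' (hw ▸ hu)
    | cons b p₂ =>
      rcases Finset.mem_insert.1 (h.2.1 b (by simp)) with rfl | hb
      · exact D.tail_ne_head _ hw.1
      · exact he' (hw.1 ▸ F.tail_mem b hb)
  · exact h'

theorem IsPath.snoc {e : A} (he : D.tail e ∈ F.verts) (he' : D.head e ∉ F.verts)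
    {r : W} (hr : r ∈ F.verts) {p : List A} (h : F.IsPath r p (D.tail e)) :
    (F.addArc e he).IsPath r (p ++ [e]) (D.head e) := by
  refine ⟨isWalk_append.2 ⟨_, h.1, rfl, rfl⟩, ?_, ?_⟩
  · intro a ha
    rcases List.mem_append.1 ha with ha | ha
    · exact Finset.mem_insert_of_mem (h.2.1 a ha)
    · rw [List.mem_singleton.1 ha]; exact Finset.mem_insert_self _ _
  · have hmem : ∀ v ∈ r :: p.map D.head, v ∈ F.verts := by
      intro v hv
      rcases List.mem_cons.1 hv with rfl | hv
      · exact hr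
      · obtain ⟨a, ha, rfl⟩ := List.mem_map.1 hv
        exact F.head_mem a (h.2.1 a ha)
    have : r :: (p ++ [e]).map D.head = (r :: p.map D.head) ++ [D.head e] := by simp
    rw [this, List.nodup_append]
    refine ⟨h.2.2, List.nodup_singleton _, ?_⟩
    intro v hv w hw hvw
    rw [List.mem_singleton.1 hw] at hvw
    exact he' (hvw ▸ hmem v hv)

theorem IsArborescence.addArc {r : W} (h : F.IsArborescence r) {e : A} (he : D.tail e ∈ F.verts)
    (he' : D.head e ∉ F.verts) : (F.addArc e he).IsArborescence r := by
  obtain ⟨hr, ht, hp⟩ := h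
  refine ⟨Finset.mem_insert_of_mem hr, isUnderlyingTree_addArc ht he he', fun u hu => ?_⟩
  rcases Finset.mem_insert.1 hu with rfl | hu
  · obtain ⟨p, hp₁, hp₂⟩ := hp _ he
    refine ⟨p ++ [e], hp₁.snoc he he' hr, fun q hq => ?_⟩
    rcases List.eq_nil_or_concat q with rfl | ⟨q, a, rfl⟩
    · exact absurd (hq.1 ▸ hr) he'
    · rw [List.concat_eq_append] at hq ⊢
      obtain ⟨v, hw, rfl, ha⟩ := isWalk_append.1 hq.1
      have hae : a = e := by
        rcases Finset.mem_insert.1 (hq.2.1 a (by simp)) with h | h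
        · exact h
        · exact absurd (ha ▸ F.head_mem a h) he'
      subst hae
      congr 1
      refine hp₂ q ((isPath_addArc_iff_of_mem he he' he).1 ⟨hw, fun b hb => hq.2.1 b (by simp [hb]),
        ?_⟩)
      refine List.Nodup.sublist ?_ hq.2.2
      simp
  · obtain ⟨p, hp₁, hp₂⟩ := hp u hu
    exact ⟨p, (isPath_addArc_iff_of_mem he he' hu).2 hp₁,
      fun q hq => hp₂ q ((isPath_addArc_iff_of_mem he he' hu).1 hq)⟩

/-- In an arborescence with root `r`, an arc from `r` to `u` that is outside a subarborescence
cannot lead to a vertex of the latter. -/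
theorem IsArborescence.head_notMem {G : D.Sub} {r : W} (hF : F.IsArborescence r)
    (hG : G.IsArborescence r) (hFG : F.IsSubOf G) {e : A} (he : e ∈ G.arcs) (he' : e ∉ F.arcs)
    (hr : D.tail e = r) : D.head e ∉ F.verts := by
  intro hu
  obtain ⟨p, hp, -⟩ := hF.2.2 _ hu
  have h₁ : G.IsPath r [e] (D.head e) :=
    ⟨⟨hr, rfl⟩, by simpa using he, by simpa using (hr ▸ D.tail_ne_head e)⟩
  have h₂ := (hG.2.2 _ (hFG.1 hu)).unique (hp.mono hFG) h₁
  exact he' (hp.2.1 e (by simp [h₂]))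

end Sub
end MultiDigraph

/-! ### In-degrees, missing indices and free arcs -/

namespace MultiDigraph

variable {W A : Type*} [Fintype W] [DecidableEq W] {D : MultiDigraph W A} {k : ℕ}

section Counting

theorem mem_inDeg_filter {X : Finset W} {a : A} :
    (D.tail a ∈ Xᶜ ∧ D.head a ∈ X) ↔ (D.tail a ∉ X ∧ D.head a ∈ X) := by
  rw [Finset.mem_compl]

theorem inDeg_eq_sum (B : Finset A) (X : Finset W) :
    D.inDeg B X = ∑ a ∈ B, if D.tail a ∉ X ∧ D.head a ∈ X then 1 else 0 := by
  simp only [inDeg, numArcs, mem_inDeg_filter, Finset.card_filter]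

theorem inDeg_inter_add_inDeg_union (B : Finset A) (X Y : Finset W) :
    D.inDeg B (X ∩ Y) + D.inDeg B (X ∪ Y) ≤ D.inDeg B X + D.inDeg B Y := by
  simp only [inDeg_eq_sum, ← Finset.sum_add_distrib, Finset.mem_inter, Finset.mem_union]
  refine Finset.sum_le_sum fun a _ => ?_
  grind

theorem inDeg_erase [DecidableEq A] {B : Finset A} {e : A} (he : e ∈ B) (X : Finset W) :
    D.inDeg (B.erase e) X + (if D.tail e ∉ X ∧ D.head e ∈ X then 1 else 0) = D.inDeg B X := by
  rw [inDeg_eq_sum, inDeg_eq_sum, Finset.sum_erase_add _ _ he]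

theorem exists_entering_of_inDeg_lt {B : Finset A} {X Y : Finset W}
    (h : D.inDeg B X < D.inDeg B Y) :
    ∃ a ∈ B, D.tail a ∉ Y ∧ D.head a ∈ Y ∧ ¬ (D.tail a ∉ X ∧ D.head a ∈ X) := by
  by_contra! hcon
  refine h.not_ge (Finset.card_le_card fun a ha => ?_)
  simp only [Finset.mem_filter, mem_inDeg_filter] at ha ⊢
  exact ⟨ha.1, hcon a ha.1 ha.2.1 ha.2.2⟩

end Counting

section Missing

variable {F : Fin k → D.Sub}

theorem mem_missing {I : Finset (Fin k)} {X : Finset W} {i : Fin k} :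
    i ∈ missing F I X ↔ i ∈ I ∧ Disjoint X (F i).verts := by
  simp [missing]

theorem missing_anti {I : Finset (Fin k)} {X Y : Finset W} (h : X ⊆ Y) :
    missing F I Y ⊆ missing F I X := fun i hi => by
  rw [mem_missing] at hi ⊢
  exact ⟨hi.1, hi.2.mono_left h⟩

theorem missing_mono {I J : Finset (Fin k)} (h : I ⊆ J) (X : Finset W) :
    missing F I X ⊆ missing F J X :=
  Finset.filter_subset_filter _ h

theorem missing_union_left (I J : Finset (Fin k)) (X : Finset W) :
    missing F (I ∪ J) X = missing F I X ∪ missing F J X :=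
  Finset.filter_union _ _ _

theorem card_missing_supermodular (I J : Finset (Fin k)) (X Y : Finset W) :
    (missing F I X).card + (missing F J Y).card ≤
      (missing F (I ∪ J) (X ∩ Y)).card + (missing F (I ∩ J) (X ∪ Y)).card := by
  rw [← Finset.card_union_add_card_inter]
  refine add_le_add (Finset.card_le_card fun i hi => ?_) (Finset.card_le_card fun i hi => ?_)
  · rw [Finset.mem_union, mem_missing, mem_missing] at hi
    rw [mem_missing]
    rcases hi with hi | hi
    · exact ⟨Finset.mem_union_left _ hi.1, hi.2.mono_left Finset.inter_subset_left⟩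
    · exact ⟨Finset.mem_union_right _ hi.1, hi.2.mono_left Finset.inter_subset_right⟩
  · rw [Finset.mem_inter, mem_missing, mem_missing] at hi
    rw [mem_missing, Finset.disjoint_union_left]
    exact ⟨Finset.mem_inter.2 ⟨hi.1.1, hi.2.1⟩, hi.1.2, hi.2.2⟩

end Missing

variable [Fintype A] [DecidableEq A] {F : Fin k → D.Sub} {x : W}

theorem mem_freeArcs {a : A} : a ∈ freeArcs F ↔ ∀ i, a ∉ (F i).arcs := by
  simp [freeArcs]

/-- The free arcs whose tail is not `x`. -/
def innerArcs (F : Fin k → D.Sub) (x : W) : Finset A :=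
  freeArcs F \ D.outArcs Finset.univ x

theorem mem_innerArcs {a : A} : a ∈ innerArcs F x ↔ a ∈ freeArcs F ∧ D.tail a ≠ x := by
  simp [innerArcs, outArcs]

/-- Adding a free arc that leaves `F i` to `F i`. -/
theorem exists_augment (hF : ∀ i, (F i).IsArborescence x) (hd : ArcDisjoint F) {i : Fin k} {e : A}
    (he : e ∈ freeArcs F) (ht : D.tail e ∈ (F i).verts) (hh : D.head e ∉ (F i).verts) :
    ∃ F' : Fin k → D.Sub, (∀ j, (F j).IsSubOf (F' j)) ∧ (∀ j, (F' j).IsArborescence x) ∧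
      ArcDisjoint F' ∧ freeArcs F' = (freeArcs F).erase e ∧
      (∀ j, (F' j).verts = if j = i then insert (D.head e) (F j).verts else (F j).verts) ∧
      (∀ I X, missing F' I X =
        if D.head e ∈ X then (missing F I X).erase i else missing F I X) ∧
      ∀ j, D.outDeg (F' j).arcs x =
        D.outDeg (F j).arcs x + if j = i ∧ D.tail e = x then 1 else 0 := by
  have he' := mem_freeArcs.1 he
  have hverts : ∀ j, (Function.update F i ((F i).addArc e ht) j).verts =
      if j = i then insert (D.head e) (F j).verts else (F j).verts := by
    intro j
    by_cases h : j = i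
    · subst h; simp [Sub.addArc]
    · simp [h]
  have harcs : ∀ j, (Function.update F i ((F i).addArc e ht) j).arcs =
      if j = i then insert e (F j).arcs else (F j).arcs := by
    intro j
    by_cases h : j = i
    · subst h; simp [Sub.addArc]
    · simp [h]
  refine ⟨Function.update F i ((F i).addArc e ht), fun j => ?_, fun j => ?_, fun j j' hjj' => ?_,
    ?_, hverts, fun I X => ?_, fun j => ?_⟩
  · by_cases h : j = i
    · subst h; simpa using (F j).isSubOf_addArc e ht
    · rw [Function.update_of_ne h]; exact ⟨subset_rfl, subset_rfl⟩
  · by_cases h : j = i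
    · subst h; simpa using (hF j).addArc ht hh
    · simpa [h] using hF j
  · have := hd j j' hjj'
    have h₁ := he' j
    have h₂ := he' j'
    rw [harcs, harcs]
    rw [Finset.disjoint_left] at this ⊢
    grind
  · ext a
    simp only [mem_freeArcs, Finset.mem_erase, harcs]
    refine ⟨fun h => ⟨?_, fun j => ?_⟩, fun h j => ?_⟩
    · rintro rfl; simpa using h i
    · have := h j; grind
    · have := h.2 j; grind
  · ext j
    rw [mem_missing, hverts]
    by_cases h : j = i
    · subst h
      by_cases hX : D.head e ∈ X <;> simp [hX, mem_missing, Finset.disjoint_insert_right]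
    · by_cases hX : D.head e ∈ X <;> simp [hX, h, mem_missing]
  · have hmem : D.tail e = x ↔ D.tail e ∈ ({x} : Finset W) ∧ D.head e ∈ ({x} : Finset W)ᶜ := by
      have := D.tail_ne_head e
      simp only [Finset.mem_singleton, Finset.mem_compl]
      grind
    rw [harcs]
    by_cases h : j = i
    · subst h
      simp only [outDeg, numArcs, if_true, true_and, Finset.filter_insert, ← hmem]
      split_ifs
      · rw [Finset.card_insert_of_notMem (by simp [he' j])]
      · rfl
    · simp [h]

theorem innerArcs_erase {F' : Fin k → D.Sub} {e : A} (h : freeArcs F' = (freeArcs F).erase e) :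
    innerArcs F' x = (innerArcs F x).erase e := by
  rw [innerArcs, innerArcs, h, Finset.erase_sdiff_comm]

/-! ### Edmonds' theorem on disjoint arborescences -/

section Spanning

/-- The arc to be added in the inductive proof of Edmonds' disjoint arborescences theorem. -/
theorem exists_safe_arc {B : Finset A} (hx : ∀ i, x ∈ (F i).verts)
    (hcov : ∀ X : Finset W, X.Nonempty → x ∉ X →
      (missing F Finset.univ X).card ≤ D.inDeg B X) {i : Fin k} (hi : ∃ v, v ∉ (F i).verts) :
    ∃ e ∈ B, D.tail e ∈ (F i).verts ∧ D.head e ∉ (F i).verts ∧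
      ∀ X, x ∉ X → D.tail e ∉ X → D.head e ∈ X → ¬ Disjoint X (F i).verts →
        (missing F Finset.univ X).card < D.inDeg B X := by
  set U := (F i).verts with hU
  -- Lovász's argument: inside a minimal tight set that meets `U` and is not contained in it, an arc
  -- from `U` to its complement is safe.
  by_cases hex : ∃ X : Finset W, x ∉ X ∧ D.inDeg B X ≤ (missing F Finset.univ X).card ∧
      ¬ Disjoint X U ∧ (X \ U).Nonempty
  · obtain ⟨X, hX, hmin⟩ := Finset.exists_min_image (Finset.univ.filter fun X : Finset W =>
      x ∉ X ∧ D.inDeg B X ≤ (missing F Finset.univ X).card ∧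
      ¬ Disjoint X U ∧ (X \ U).Nonempty) Finset.card (by
        obtain ⟨X, hX⟩ := hex
        exact ⟨X, by simpa using hX⟩)
    simp only [Finset.mem_filter, Finset.mem_univ, true_and] at hX hmin
    obtain ⟨hxX, hXt, hXU, hXne⟩ := hX
    have hlt : (missing F Finset.univ X).card < (missing F Finset.univ (X \ U)).card := by
      refine Finset.card_lt_card (Finset.ssubset_iff_of_subset
        (missing_anti Finset.sdiff_subset) |>.2 ⟨i, ?_, ?_⟩)
      · exact mem_missing.2 ⟨Finset.mem_univ _, Finset.sdiff_disjoint⟩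
      · exact fun h => hXU (mem_missing.1 h).2
    -- More arcs enter `X \ U` than `X`, so some arc enters `X \ U` from within `X`, hence from `X ∩
    -- U`.
    obtain ⟨e, he, het, heh, hne⟩ := exists_entering_of_inDeg_lt
      (hXt.trans_lt (hlt.trans_le (hcov _ hXne fun h => hxX (Finset.mem_sdiff.1 h).1)))
    rw [Finset.mem_sdiff] at het heh
    have hetX : D.tail e ∈ X := by tauto
    refine ⟨e, he, by tauto, heh.2, fun Z hxZ htZ hhZ hZU => ?_⟩
    by_contra! hZt
    have hxXZ : x ∉ X ∪ Z := by simp [hxX, hxZ]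
    have hxXZ' : x ∉ X ∩ Z := by simp [hxX]
    have h₁ := hcov (X ∪ Z) ⟨D.head e, by simp [hhZ]⟩ hxXZ
    have h₂ := hcov (X ∩ Z) ⟨D.head e, by simp [hhZ, heh.1]⟩ hxXZ'
    have h₃ := D.inDeg_inter_add_inDeg_union B X Z
    -- If so, `i` is missing at `X ∩ Z` but at neither `X` nor `Z`, and supermodularity is strict,
    -- which is impossible for tight sets. If not, `X ∩ Z` is a smaller tight set of the same kind,
    -- without the tail of `e`.
    by_cases hdis : Disjoint (X ∩ Z) U
    · have hcard : (missing F Finset.univ X ∪ missing F Finset.univ Z).card <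
          (missing F Finset.univ (X ∩ Z)).card := by
        refine Finset.card_lt_card (Finset.ssubset_iff_of_subset (Finset.union_subset
          (missing_anti Finset.inter_subset_left) (missing_anti Finset.inter_subset_right))
          |>.2 ⟨i, ?_, ?_⟩)
        · exact mem_missing.2 ⟨Finset.mem_univ _, hdis⟩
        · rw [Finset.mem_union, mem_missing, mem_missing]
          tauto
      have hcard' : (missing F Finset.univ X ∩ missing F Finset.univ Z).card ≤
          (missing F Finset.univ (X ∪ Z)).card := by
        refine Finset.card_le_card fun j hj => ?_
        rw [Finset.mem_inter, mem_missing, mem_missing] at hj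
        exact mem_missing.2 ⟨hj.1.1, Finset.disjoint_union_left.2 ⟨hj.1.2, hj.2.2⟩⟩
      have := Finset.card_union_add_card_inter (missing F Finset.univ X) (missing F Finset.univ Z)
      omega
    · have h₄ := card_missing_supermodular (F := F) Finset.univ Finset.univ X Z
      rw [Finset.union_self, Finset.inter_self] at h₄
      have h₅ := hmin (X ∩ Z) ⟨hxXZ', by omega, hdis,
        ⟨D.head e, by simp [heh.1, heh.2, hhZ]⟩⟩
      have h₆ : (X ∩ Z).card < X.card := Finset.card_lt_card
        ((Finset.ssubset_iff_of_subset Finset.inter_subset_left).2 ⟨D.tail e, hetX, by simp [htZ]⟩)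
      omega
  · obtain ⟨v, hv⟩ := hi
    have hpos : 0 < D.inDeg B Uᶜ := by
      refine lt_of_lt_of_le (Finset.card_pos.2 ⟨i, ?_⟩)
        (hcov Uᶜ ⟨v, by simpa using hv⟩ (by simpa using hx i))
      exact mem_missing.2 ⟨Finset.mem_univ _, disjoint_compl_left⟩
    obtain ⟨e, he, het, heh, -⟩ := exists_entering_of_inDeg_lt
      (D := D) (B := B) (X := ∅) (Y := Uᶜ) (by simpa only [inDeg_eq_sum B ∅, Finset.notMem_empty,
        and_false, if_false, Finset.sum_const_zero] using hpos)
    rw [Finset.mem_compl] at heh het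
    refine ⟨e, he, by tauto, heh, fun Z hxZ htZ hhZ hZU => ?_⟩
    by_contra! hZt
    exact hex ⟨Z, hxZ, hZt, hZU, ⟨_, Finset.mem_sdiff.2 ⟨hhZ, heh⟩⟩⟩

/-- Edmonds' theorem: extension of arc-disjoint arborescences to spanning ones, without using
further arcs at the root. -/
theorem exists_spanning_extension (n : ℕ) : ∀ F : Fin k → D.Sub,
    (∀ i, (F i).IsArborescence x) → ArcDisjoint F →
    (∀ X : Finset W, X.Nonempty → x ∉ X →
      (missing F Finset.univ X).card ≤ D.inDeg (innerArcs F x) X) →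
    ∑ i, ((F i).vertsᶜ).card = n →
    ∃ F' : Fin k → D.Sub, (∀ i, (F i).IsSubOf (F' i)) ∧
      (∀ i, (F' i).IsArborescence x ∧ (F' i).IsSpanning) ∧ ArcDisjoint F' ∧
      ∀ i, D.outDeg (F' i).arcs x = D.outDeg (F i).arcs x := by
  induction n with
  | zero =>
    intro F hF hd _ hn
    refine ⟨F, fun i => ⟨subset_rfl, subset_rfl⟩, fun i => ⟨hF i, fun v => ?_⟩, hd, fun i => rfl⟩
    have := Finset.card_eq_zero.1 (Finset.sum_eq_zero_iff.1 hn i (Finset.mem_univ i))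
    by_contra hv
    simpa [this] using Finset.mem_compl.2 hv
  | succ n ih =>
    intro F hF hd hcov hn
    obtain ⟨i, v, hv⟩ : ∃ i, ∃ v, v ∉ (F i).verts := by
      by_contra! h
      have : ∀ i, (F i).verts = Finset.univ := fun i => Finset.eq_univ_iff_forall.2 (h i)
      simp [this] at hn
    obtain ⟨e, he, het, heh, hsafe⟩ := exists_safe_arc (fun i => (hF i).1) hcov ⟨v, hv⟩
    obtain ⟨F₁, hsub, hF₁, hd₁, hfree, hverts, hmiss, hout⟩ :=
      exists_augment hF hd (mem_innerArcs.1 he).1 het heh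
    have hih := ih F₁ hF₁ hd₁ ?_ ?_
    · obtain ⟨F', hsub', hF', hd', hout'⟩ := hih
      refine ⟨F', fun j => ⟨(hsub j).1.trans (hsub' j).1, (hsub j).2.trans (hsub' j).2⟩, hF', hd',
        fun j => ?_⟩
      rw [hout', hout, if_neg (fun h => (mem_innerArcs.1 he).2 h.2), add_zero]
    · intro X hX hxX
      rw [hmiss, innerArcs_erase hfree]
      have h₁ := inDeg_erase (D := D) he X
      have h₂ := hcov X hX hxX
      by_cases hhX : D.head e ∈ X
      · rw [if_pos hhX]
        by_cases htX : D.tail e ∈ X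
        · have := Finset.card_erase_le (s := missing F Finset.univ X) (a := i)
          simp only [htX, not_true_eq_false, false_and, if_false] at h₁
          omega
        · simp only [htX, hhX, not_false_eq_true, and_self, if_true] at h₁
          by_cases hdis : Disjoint X (F i).verts
          · rw [Finset.card_erase_of_mem (mem_missing.2 ⟨Finset.mem_univ _, hdis⟩)]
            omega
          · have := hsafe X hxX htX hhX hdis
            have := Finset.card_erase_le (s := missing F Finset.univ X) (a := i)
            omega
      · simp only [hhX, and_false, if_false] at h₁ ⊢
        omega
    · have h₁ : ∀ j, ((F₁ j).vertsᶜ).card + (if j = i then 1 else 0) = ((F j).vertsᶜ).card := by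
        intro j
        rw [hverts]
        by_cases h : j = i
        · subst h
          simp only [if_true]
          rw [Finset.compl_insert]
          exact Finset.card_erase_add_one (Finset.mem_compl.2 heh)
        · simp [h]
      have h₂ := Finset.sum_congr rfl fun j (_ : j ∈ Finset.univ) => h₁ j
      rw [Finset.sum_add_distrib, hn, Finset.sum_ite_eq' Finset.univ i] at h₂
      simpa using h₂

end Spanning

/-! ### Handing root arcs to individual arborescences -/

section RootArcs

variable {Λ : Type*} [DecidableEq Λ]

/-- The indices whose part belongs to `S`. -/
def indicesOf (κ : Fin k → Λ) (S : Finset Λ) : Finset (Fin k) :=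
  Finset.univ.filter fun i => κ i ∈ S

theorem mem_indicesOf {κ : Fin k → Λ} {S : Finset Λ} {i : Fin k} :
    i ∈ indicesOf κ S ↔ κ i ∈ S := by
  simp [indicesOf]

theorem indicesOf_union (κ : Fin k → Λ) (S T : Finset Λ) :
    indicesOf κ (S ∪ T) = indicesOf κ S ∪ indicesOf κ T := by
  ext i; simp [mem_indicesOf]

theorem indicesOf_inter (κ : Fin k → Λ) (S T : Finset Λ) :
    indicesOf κ (S ∩ T) = indicesOf κ S ∩ indicesOf κ T := by
  ext i; simp [mem_indicesOf]

/-- The member of part `α` to which an arc from the root to `u` is added. -/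
theorem exists_safe_index {κ : Fin k → Λ} {B : Finset A} {m : Λ → W → ℕ} {α : Λ} {u : W}
    (hcov : ∀ S, ∀ X : Finset W, X.Nonempty → x ∉ X →
      (missing F (indicesOf κ S) X).card ≤ D.inDeg B X + ∑ β ∈ S, ∑ v ∈ X, m β v)
    (hm : m α u ≤ (missing F (indicesOf κ {α}) {u}).card) (hpos : 0 < m α u) :
    ∃ i, κ i = α ∧ u ∉ (F i).verts ∧ ∀ S, ∀ X : Finset W, x ∉ X → α ∈ S → u ∈ X →
      ¬ Disjoint X (F i).verts →
        (missing F (indicesOf κ S) X).card < D.inDeg B X + ∑ β ∈ S, ∑ v ∈ X, m β v := by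
  by_cases hex : ∃ X : Finset W, x ∉ X ∧ u ∈ X ∧ ∃ S, α ∈ S ∧
      D.inDeg B X + ∑ β ∈ S, ∑ v ∈ X, m β v ≤ (missing F (indicesOf κ S) X).card
  · classical
    obtain ⟨Z, hZ, hmax⟩ := Finset.exists_max_image (Finset.univ.filter fun X : Finset W =>
      x ∉ X ∧ u ∈ X ∧ ∃ S, α ∈ S ∧
      D.inDeg B X + ∑ β ∈ S, ∑ v ∈ X, m β v ≤ (missing F (indicesOf κ S) X).card) Finset.card (by
        obtain ⟨X, hX⟩ := hex
        exact ⟨X, by simpa using hX⟩)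
    simp only [Finset.mem_filter, Finset.mem_univ, true_and] at hZ hmax
    obtain ⟨hxZ, huZ, R, hαR, hZt⟩ := hZ
    -- Dropping `α` from `R` lowers the right-hand side by at least `m α u > 0`. Since `(R, Z)` is
    -- tight, part `α` must have a member missing `Z`.
    obtain ⟨i, hi⟩ : (missing F (indicesOf κ {α}) Z).Nonempty := by
      rw [← Finset.card_pos]
      have h₁ := hcov (R.erase α) Z ⟨u, huZ⟩ hxZ
      have h₂ : missing F (indicesOf κ R) Z =
          missing F (indicesOf κ (R.erase α)) Z ∪ missing F (indicesOf κ {α}) Z := by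
        rw [← missing_union_left, ← indicesOf_union, Finset.union_comm, ← Finset.insert_eq,
          Finset.insert_erase hαR]
      have h₃ := Finset.card_union_le (missing F (indicesOf κ (R.erase α)) Z)
        (missing F (indicesOf κ {α}) Z)
      rw [← h₂] at h₃
      have h₄ := Finset.add_sum_erase R (fun β => ∑ v ∈ Z, m β v) hαR
      have h₅ : m α u ≤ ∑ v ∈ Z, m α v := Finset.single_le_sum (fun _ _ => Nat.zero_le _) huZ
      omega
    rw [mem_missing, mem_indicesOf, Finset.mem_singleton] at hi
    refine ⟨i, hi.1, Finset.disjoint_left.1 hi.2 huZ, fun S X hxX hαS huX hdis => ?_⟩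
    by_contra! hXt
    have hxXZ : x ∉ X ∪ Z := by simp [hxX, hxZ]
    have h₁ := hcov (S ∪ R) (X ∩ Z) ⟨u, by simp [huX, huZ]⟩ (by simp [hxX])
    have h₂ := hcov (S ∩ R) (X ∪ Z) ⟨u, by simp [huX]⟩ hxXZ
    have h₃ := D.inDeg_inter_add_inDeg_union B X Z
    have h₄ := card_missing_supermodular (F := F) (indicesOf κ S) (indicesOf κ R) X Z
    rw [← indicesOf_union, ← indicesOf_inter] at h₄
    have h₅ : ∑ β ∈ S ∪ R, ∑ v ∈ X ∩ Z, m β v + ∑ β ∈ S ∩ R, ∑ v ∈ X ∪ Z, m β v ≤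
        ∑ β ∈ S, ∑ v ∈ X, m β v + ∑ β ∈ R, ∑ v ∈ Z, m β v := by
      simp only [← Finset.sum_product']
      rw [← Finset.sum_union_inter, ← Finset.sum_union_inter (s₁ := S ×ˢ X)]
      refine add_le_add (Finset.sum_le_sum_of_subset ?_) (Finset.sum_le_sum_of_subset ?_)
      · grind
      · grind
    -- Uncrossing makes `X ∪ Z` tight with label `S ∩ R ∋ α`, so maximality puts `X` inside `Z`,
    -- which `F i` avoids.
    have h₆ := hmax (X ∪ Z) ⟨hxXZ, by simp [huX], S ∩ R, by simp [hαS, hαR], by omega⟩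
    have h₇ := Finset.eq_of_subset_of_card_le Finset.subset_union_right h₆
    exact hdis (hi.2.mono_left (h₇ ▸ Finset.subset_union_left))
  · obtain ⟨i, hi⟩ : (missing F (indicesOf κ {α}) {u}).Nonempty := by
      rw [← Finset.card_pos]; omega
    rw [mem_missing, mem_indicesOf, Finset.mem_singleton, Finset.disjoint_singleton_left] at hi
    refine ⟨i, hi.1, hi.2, fun S X hxX hαS huX _ => ?_⟩
    by_contra! hXt
    exact hex ⟨X, hxX, huX, S, hαS, hXt⟩

end RootArcs

end MultiDigraph

namespace MultiDigraph

variable {W A : Type*} [Fintype W] [DecidableEq W] [Fintype A] [DecidableEq A]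
  {D : MultiDigraph W A} {k : ℕ} {x : W}

theorem sum_sub_indicator {Λ V : Type*} [DecidableEq Λ] [DecidableEq V] {m : Λ → V → ℕ} {α : Λ}
    {u : V} (h : 0 < m α u) (S : Finset Λ) (X : Finset V) :
    ∑ β ∈ S, ∑ v ∈ X, (m β v - if β = α ∧ v = u then 1 else 0) +
      (if α ∈ S ∧ u ∈ X then 1 else 0) = ∑ β ∈ S, ∑ v ∈ X, m β v := by
  have h₁ : ∀ β v, m β v = (m β v - if β = α ∧ v = u then 1 else 0) +
      if β = α then if v = u then 1 else 0 else 0 := by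
    intro β v
    by_cases hβ : β = α <;> by_cases hv : v = u
    · subst hβ hv; simp; omega
    all_goals simp [hβ, hv]
  conv_rhs => simp only [Finset.sum_congr rfl fun β _ => Finset.sum_congr rfl fun v _ => h₁ β v]
  simp only [Finset.sum_add_distrib, Finset.sum_ite_irrel, Finset.sum_ite_eq',
    Finset.sum_const_zero, ite_and]

/-- Each step spends one unit of `m` on a free root arc, given to the index from
`exists_safe_index`. A tight pair losing a unit on the right also loses that index on the left. Once
`m` vanishes, the covering condition is Edmonds' condition. -/
theorem exists_root_extension {Λ : Type*} [Fintype Λ] [DecidableEq Λ] (κ : Fin k → Λ) (n : ℕ) :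
    ∀ (F : Fin k → D.Sub) (m : Λ → W → ℕ), (∀ i, (F i).IsArborescence x) → ArcDisjoint F →
      (∀ S, ∀ X : Finset W, X.Nonempty → x ∉ X →
        (missing F (indicesOf κ S) X).card ≤
          D.inDeg (innerArcs F x) X + ∑ β ∈ S, ∑ v ∈ X, m β v) →
      (∀ α u, u ≠ x → m α u ≤ (missing F (indicesOf κ {α}) {u}).card) →
      (∀ u, u ≠ x → ∑ α, m α u ≤ D.numArcs (freeArcs F) {x} {u}) →
      ∑ α, ∑ u ∈ Finset.univ.erase x, m α u = n →
      ∃ F' : Fin k → D.Sub, (∀ i, (F i).IsSubOf (F' i)) ∧ (∀ i, (F' i).IsArborescence x) ∧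
        ArcDisjoint F' ∧
        (∀ X : Finset W, X.Nonempty → x ∉ X →
          (missing F' Finset.univ X).card ≤ D.inDeg (innerArcs F' x) X) ∧
        ∀ α, ∑ i with κ i = α, D.outDeg (F' i).arcs x =
          ∑ i with κ i = α, D.outDeg (F i).arcs x + ∑ u ∈ Finset.univ.erase x, m α u := by
  induction n with
  | zero =>
    intro F m hF hd hcov _ _ hn
    have hm : ∀ α, ∀ u ∈ Finset.univ.erase x, m α u = 0 := by
      simpa using hn
    refine ⟨F, fun i => ⟨subset_rfl, subset_rfl⟩, hF, hd, fun X hX hxX => ?_, fun α => ?_⟩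
    · have h₁ := hcov Finset.univ X hX hxX
      rw [Finset.sum_eq_zero fun α _ => Finset.sum_eq_zero fun u hu => hm α u
        (Finset.mem_erase.2 ⟨fun h => hxX (h ▸ hu), Finset.mem_univ _⟩)] at h₁
      simpa [indicesOf] using h₁
    · rw [Finset.sum_eq_zero (hm α), add_zero]
  | succ n ih =>
    intro F m hF hd hcov hm hnum hn
    obtain ⟨α, u, hux, hpos⟩ : ∃ α u, u ≠ x ∧ 0 < m α u := by
      by_contra! h
      rw [Finset.sum_eq_zero fun α _ => Finset.sum_eq_zero fun u hu =>
        Nat.le_zero.1 (h α u (Finset.ne_of_mem_erase hu))] at hn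
      omega
    obtain ⟨i, hi, hui, hsafe⟩ := exists_safe_index hcov (hm α u hux) hpos
    obtain ⟨e, he⟩ : ((freeArcs F).filter fun a => D.tail a ∈ ({x} : Finset W) ∧
        D.head a ∈ ({u} : Finset W)).Nonempty := by
      rw [← Finset.card_pos]
      exact hpos.trans_le ((Finset.single_le_sum (f := fun α => m α u) (fun _ _ => Nat.zero_le _)
        (Finset.mem_univ α)).trans (hnum u hux))
    simp only [Finset.mem_filter, Finset.mem_singleton] at he
    obtain ⟨hef, het, heh⟩ := he
    obtain ⟨F₁, hsub, hF₁, hd₁, hfree, hverts, hmiss, hout⟩ :=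
      exists_augment hF hd hef (het ▸ (hF i).1) (heh ▸ hui)
    simp only [heh, het] at hmiss hout
    have hinner : innerArcs F₁ x = innerArcs F x := by
      rw [innerArcs_erase hfree, Finset.erase_eq_of_notMem fun h => (mem_innerArcs.1 h).2 het]
    have hih := ih F₁ (fun β v => m β v - if β = α ∧ v = u then 1 else 0) hF₁ hd₁ ?_ ?_ ?_ ?_
    · obtain ⟨F', hsub', hF', hd', hcov', hout'⟩ := hih
      refine ⟨F', fun j => ⟨(hsub j).1.trans (hsub' j).1, (hsub j).2.trans (hsub' j).2⟩, hF', hd',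
        hcov', fun β => ?_⟩
      rw [hout', Finset.sum_congr rfl fun j _ => hout j, Finset.sum_add_distrib]
      have h₁ := sum_sub_indicator hpos {β} (Finset.univ.erase x)
      simp only [Finset.sum_singleton, Finset.mem_singleton] at h₁
      rw [← h₁]
      have h₂ : (∑ j with κ j = β, if j = i ∧ True then 1 else 0) =
          if α = β ∧ u ∈ Finset.univ.erase x then 1 else 0 := by
        simp [hux, hi]
      simp only [h₂]
      omega
    · intro S X hX hxX
      rw [hinner, hmiss]
      have h₁ := sum_sub_indicator hpos S X
      have h₂ := hcov S X hX hxX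
      by_cases huX : u ∈ X
      · have h₃ := Finset.card_erase_le (s := missing F (indicesOf κ S) X) (a := i)
        rw [if_pos huX]
        by_cases hαS : α ∈ S
        · rw [if_pos ⟨hαS, huX⟩] at h₁
          by_cases hdis : Disjoint X (F i).verts
          · rw [Finset.card_erase_of_mem (mem_missing.2 ⟨mem_indicesOf.2 (hi ▸ hαS), hdis⟩)]
            omega
          · have := hsafe S X hxX hαS huX hdis
            omega
        · rw [if_neg fun h => hαS h.1] at h₁
          omega
      · rw [if_neg huX]
        rw [if_neg fun h => huX h.2] at h₁
        omega
    · intro β v hvx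
      rw [hmiss]
      have h₁ := hm β v hvx
      by_cases hv : v = u
      · subst hv
        rw [if_pos (Finset.mem_singleton_self _)]
        by_cases hβ : β = α
        · subst hβ
          rw [Finset.card_erase_of_mem (mem_missing.2 ⟨mem_indicesOf.2 (by simp [hi]),
            Finset.disjoint_singleton_left.2 hui⟩)]
          simp only [and_self, if_true]
          omega
        · rw [Finset.erase_eq_of_notMem]
          · simpa [hβ] using h₁
          · intro h
            exact hβ ((Finset.mem_singleton.1 (mem_indicesOf.1 (mem_missing.1 h).1)).symm.trans hi)
      · have huv : u ∉ ({v} : Finset W) := fun h => hv (Finset.mem_singleton.1 h).symm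
        rw [if_neg huv]
        simpa [hv] using h₁
    · intro v hvx
      have h₁ := hnum v hvx
      have h₂ := sum_sub_indicator hpos Finset.univ {v}
      simp only [Finset.sum_singleton, Finset.mem_singleton, Finset.mem_univ, true_and] at h₂
      have h₃ : D.numArcs (freeArcs F₁) {x} {v} + (if u = v then 1 else 0) =
          D.numArcs (freeArcs F) {x} {v} := by
        rw [hfree, numArcs, numArcs, Finset.filter_erase]
        split_ifs with h
        · refine Finset.card_erase_add_one (Finset.mem_filter.2 ⟨hef, ?_⟩)
          simp [het, heh, h]
        · rw [Finset.erase_eq_of_notMem, add_zero]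
          simp [heh, h]
      omega
    · have h₁ := sum_sub_indicator hpos Finset.univ (Finset.univ.erase x)
      rw [if_pos ⟨Finset.mem_univ _, Finset.mem_erase.2 ⟨hux, Finset.mem_univ _⟩⟩, hn] at h₁
      omega

end MultiDigraph

/-! ### The demand function for root arcs -/

namespace MultiDigraph

variable {W A : Type*} [Fintype W] [DecidableEq W] [Fintype A] [DecidableEq A]
  {D : MultiDigraph W A} {k : ℕ} {x : W} {F : Fin k → D.Sub}

theorem inDeg_freeArcs {X : Finset W} (hx : x ∉ X) :
    D.inDeg (freeArcs F) X =
      D.inDeg (innerArcs F x) X + ∑ u ∈ X, D.numArcs (freeArcs F) {x} {u} := by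
  have h₁ : (freeArcs F).filter (fun a => D.tail a ∈ Xᶜ ∧ D.head a ∈ X) =
      ((innerArcs F x).filter fun a => D.tail a ∈ Xᶜ ∧ D.head a ∈ X) ∪
        (freeArcs F).filter fun a => D.tail a = x ∧ D.head a ∈ X := by
    ext a
    simp only [Finset.mem_filter, Finset.mem_union, mem_innerArcs, Finset.mem_compl]
    have : D.tail a = x → D.tail a ∉ X := fun h => h ▸ hx
    tauto
  have h₂ : ∑ u ∈ X, D.numArcs (freeArcs F) {x} {u} =
      ((freeArcs F).filter fun a => D.tail a = x ∧ D.head a ∈ X).card := by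
    rw [Finset.card_eq_sum_card_fiberwise (f := D.head) (t := X)
      (fun a ha => (Finset.mem_filter.1 ha).2.2)]
    refine Finset.sum_congr rfl fun u hu => ?_
    rw [numArcs, Finset.filter_filter]
    congr 1
    ext a
    simp only [Finset.mem_filter, Finset.mem_singleton]
    constructor
    · rintro ⟨h, rfl, rfl⟩; exact ⟨h, ⟨rfl, hu⟩, rfl⟩
    · rintro ⟨h, ⟨h', -⟩, h''⟩; exact ⟨h, h', h''⟩
  rw [inDeg, numArcs, h₁, Finset.card_union_of_disjoint, h₂]
  · rfl
  · rw [Finset.disjoint_left]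
    intro a ha hb
    exact (mem_innerArcs.1 (Finset.mem_filter.1 ha).1).2 (Finset.mem_filter.1 hb).2.1

section Demand

variable {Λ : Type*} [Fintype Λ] [DecidableEq Λ]

/-- The number of arcs that must enter `X`, in arborescences with index in a part of `S`, beyond
those available outside the root. -/
def deficit (F : Fin k → D.Sub) (x : W) (κ : Fin k → Λ) (S : Finset (Option Λ)) (X : Finset W) :
    ℤ :=
  (missing F (indicesOf (some ∘ κ) S) X).card - D.inDeg (innerArcs F x) X

/-- For `X = {u}`, the number of free arcs from the root to `u` that cannot be used by
arborescences with index outside the parts of `S`. -/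
def surplus (F : Fin k → D.Sub) (x : W) (κ : Fin k → Λ) (S : Finset (Option Λ)) (X : Finset W) :
    ℤ :=
  ∑ u ∈ X, (D.numArcs (freeArcs F) {x} {u} : ℤ) - (missing F (indicesOf (some ∘ κ) Sᶜ) X).card

/-- The demand for arcs from the root into `X` with a label in `S`, where the label `none` stands
for unused arcs. -/
def demand (F : Fin k → D.Sub) (x : W) (κ : Fin k → Λ) (S : Finset (Option Λ)) (X : Finset W) :
    ℤ :=
  if none ∈ S ∧ X.card = 1 then max (deficit F x κ S X) (surplus F x κ S X) else deficit F x κ S X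

variable {κ : Fin k → Λ} {S T : Finset (Option Λ)} {X Y : Finset W}

theorem deficit_le_demand : deficit F x κ S X ≤ demand F x κ S X := by
  rw [demand]; split_ifs <;> simp

theorem surplus_le_demand (hS : none ∈ S) (hX : X.card = 1) :
    surplus F x κ S X ≤ demand F x κ S X := by
  rw [demand, if_pos ⟨hS, hX⟩]; exact le_max_right _ _

theorem demand_cases : demand F x κ S X = deficit F x κ S X ∨
    none ∈ S ∧ X.card = 1 ∧ demand F x κ S X = surplus F x κ S X := by
  rw [demand]
  split_ifs with h
  · rcases max_choice (deficit F x κ S X) (surplus F x κ S X) with h' | h'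
    · exact Or.inl h'
    · exact Or.inr ⟨h.1, h.2, h'⟩
  · exact Or.inl rfl

theorem deficit_mono (h : T ⊆ S) : deficit F x κ T X ≤ deficit F x κ S X := by
  have := Finset.card_le_card (missing_mono (F := F) (I := indicesOf (some ∘ κ) T)
    (J := indicesOf (some ∘ κ) S) (fun i hi => mem_indicesOf.2 (h (mem_indicesOf.1 hi))) X)
  simp only [deficit]
  omega

theorem surplus_mono (h : T ⊆ S) : surplus F x κ T X ≤ surplus F x κ S X := by
  have := Finset.card_le_card (missing_mono (F := F) (I := indicesOf (some ∘ κ) Sᶜ)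
    (J := indicesOf (some ∘ κ) Tᶜ) (fun i hi => mem_indicesOf.2
      (Finset.compl_subset_compl.2 h (mem_indicesOf.1 hi))) X)
  simp only [surplus]
  omega

theorem card_missing_eq_sum (I : Finset (Fin k)) (X : Finset W) :
    (missing F I X).card = ∑ i, if i ∈ I ∧ Disjoint X (F i).verts then 1 else 0 := by
  rw [← Finset.card_filter]
  congr 1
  ext i
  simp [mem_missing]

theorem deficit_bisupermodular : IsBisupermodular (deficit F x κ) := by
  intro S T X Y _
  have h₁ := card_missing_supermodular (F := F) (indicesOf (some ∘ κ) S) (indicesOf (some ∘ κ) T) X Y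
  have h₂ := D.inDeg_inter_add_inDeg_union (innerArcs F x) X Y
  rw [← indicesOf_union, ← indicesOf_inter] at h₁
  simp only [deficit]
  omega

theorem surplus_add_deficit_le (h : X ⊆ Y) : surplus F x κ S X + deficit F x κ T Y ≤
    surplus F x κ (S ∪ T) X + deficit F x κ (S ∩ T) Y := by
  have : (missing F (indicesOf (some ∘ κ) T) Y).card +
      (missing F (indicesOf (some ∘ κ) (S ∪ T)ᶜ) X).card ≤
      (missing F (indicesOf (some ∘ κ) Sᶜ) X).card +
        (missing F (indicesOf (some ∘ κ) (S ∩ T)) Y).card := by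
    simp only [card_missing_eq_sum, ← Finset.sum_add_distrib]
    refine Finset.sum_le_sum fun i _ => ?_
    have := fun h' : Disjoint Y (F i).verts => h'.mono_left h
    simp only [mem_indicesOf, Finset.mem_compl, Finset.mem_union, Finset.mem_inter]
    grind
  simp only [surplus, deficit]
  omega

theorem surplus_add_surplus_le : surplus F x κ S X + surplus F x κ T X ≤
    surplus F x κ (S ∪ T) X + surplus F x κ (S ∩ T) X := by
  have : (missing F (indicesOf (some ∘ κ) (S ∪ T)ᶜ) X).card +
      (missing F (indicesOf (some ∘ κ) (S ∩ T)ᶜ) X).card ≤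
      (missing F (indicesOf (some ∘ κ) Sᶜ) X).card +
        (missing F (indicesOf (some ∘ κ) Tᶜ) X).card := by
    simp only [card_missing_eq_sum, ← Finset.sum_add_distrib]
    refine Finset.sum_le_sum fun i _ => ?_
    simp only [mem_indicesOf, Finset.mem_compl, Finset.mem_union, Finset.mem_inter]
    grind
  simp only [surplus]
  omega

/-- A singleton that meets `Y` lies in `Y`, so intersection returns the singleton and union returns
`Y`. The label `none` persists in `S ∪ T`, so the surplus stays available at the singleton. -/
theorem demand_bisupermodular : IsBisupermodular (demand F x κ) := by
  have key : ∀ S T X Y, (X ∩ Y).Nonempty → none ∈ S → X.card = 1 →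
      surplus F x κ S X + demand F x κ T Y ≤
        demand F x κ (S ∪ T) (X ∩ Y) + demand F x κ (S ∩ T) (X ∪ Y) := by
    intro S T X Y hne hS hX
    have hXY : X ⊆ Y := by
      obtain ⟨u, rfl⟩ := Finset.card_eq_one.1 hX
      obtain ⟨v, hv⟩ := hne
      rw [Finset.mem_inter, Finset.mem_singleton] at hv
      exact Finset.singleton_subset_iff.2 (hv.1 ▸ hv.2)
    rw [Finset.inter_eq_left.2 hXY, Finset.union_eq_right.2 hXY]
    have h₁ : surplus F x κ (S ∪ T) X ≤ demand F x κ (S ∪ T) X :=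
      surplus_le_demand (Finset.mem_union_left _ hS) hX
    rcases demand_cases (F := F) (x := x) (κ := κ) (S := T) (X := Y) with h | ⟨hT, hY, h⟩
    · have h₂ := surplus_add_deficit_le (F := F) (x := x) (κ := κ) (S := S) (T := T) hXY
      have h₃ : deficit F x κ (S ∩ T) Y ≤ demand F x κ (S ∩ T) Y := deficit_le_demand
      linarith
    · have hXY' : X = Y := Finset.eq_of_subset_of_card_le hXY (hY.trans hX.symm).le
      subst hXY'
      have h₂ := surplus_add_surplus_le (F := F) (x := x) (κ := κ) (S := S) (T := T) (X := X)
      have h₃ : surplus F x κ (S ∩ T) X ≤ demand F x κ (S ∩ T) X :=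
        surplus_le_demand (Finset.mem_inter.2 ⟨hS, hT⟩) hX
      linarith
  intro S T X Y hne
  rcases demand_cases (F := F) (x := x) (κ := κ) (S := S) (X := X) with h | ⟨hS, hX, h⟩
  · rcases demand_cases (F := F) (x := x) (κ := κ) (S := T) (X := Y) with h' | ⟨hT, hY, h'⟩
    · have h₁ := deficit_bisupermodular (F := F) (x := x) (κ := κ) S T X Y hne
      have h₂ : deficit F x κ (S ∪ T) (X ∩ Y) ≤ demand F x κ (S ∪ T) (X ∩ Y) := deficit_le_demand
      have h₃ : deficit F x κ (S ∩ T) (X ∪ Y) ≤ demand F x κ (S ∩ T) (X ∪ Y) := deficit_le_demand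
      linarith
    · rw [h', add_comm, Finset.union_comm S, Finset.inter_comm X, Finset.inter_comm S,
        Finset.union_comm X]
      exact key T S Y X (by rwa [Finset.inter_comm]) hT hY
  · rw [h]
    exact key S T X Y hne hS hX

/-- A packing for `demand` is bounded by a subpartition and the surpluses outside of it. -/
theorem exists_subpartition {U : Finset W} {v : ℤ} (h : PackingValue (demand F x κ) S U v) :
    ∃ (t : ℕ) (X : Fin t → Finset W), (∀ j, (X j).Nonempty ∧ X j ⊆ U) ∧
      (∀ j j', j ≠ j' → Disjoint (X j) (X j')) ∧
      v ≤ ∑ j, deficit F x κ S (X j) +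
        if none ∈ S then ∑ u ∈ U \ Finset.univ.biUnion X, max 0 (surplus F x κ S {u}) else 0 := by
  induction h with
  | nil U =>
    refine ⟨0, Fin.elim0, fun j => j.elim0, fun j => j.elim0, ?_⟩
    split_ifs
    · simpa using Finset.sum_nonneg fun u _ => le_max_left 0 (surplus F x κ S {u})
    · simp
  | @cons U T Y v hT hY hYU _ ih =>
    obtain ⟨t, X, hX, hdis, hle⟩ := ih
    have hXY : ∀ j, Disjoint Y (X j) := fun j =>
      Finset.disjoint_sdiff.mono_right (hX j).2
    -- Members valued by their deficit form the subpartition; singletons valued by their surplus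
    -- stay outside and are paid for by the remainder term.
    rcases demand_cases (F := F) (x := x) (κ := κ) (S := T) (X := Y) with h | ⟨hnT, hYc, h⟩
    · refine ⟨t + 1, Fin.cons Y X, ?_, ?_, ?_⟩
      · refine Fin.cases ⟨hY, hYU⟩ fun j => ⟨(hX j).1, (hX j).2.trans Finset.sdiff_subset⟩
      · refine Fin.cases (Fin.cases (fun h => absurd rfl h) fun j _ => hXY j) fun i =>
          Fin.cases (fun _ => (hXY i).symm) fun j hij => hdis i j fun h => hij (h ▸ rfl)
      · have h₁ : U \ Finset.univ.biUnion (Fin.cons Y X : Fin (t + 1) → Finset W) =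
            (U \ Y) \ Finset.univ.biUnion X := by
          ext a
          simp only [Finset.mem_sdiff, Finset.mem_biUnion, Finset.mem_univ, true_and,
            Fin.exists_fin_succ, Fin.cons_zero, Fin.cons_succ]
          tauto
        rw [h₁, Fin.sum_univ_succ, h]
        simp only [Fin.cons_zero, Fin.cons_succ]
        have := deficit_mono (F := F) (x := x) (κ := κ) (X := Y) hT
        linarith
    · refine ⟨t, X, fun j => ⟨(hX j).1, (hX j).2.trans Finset.sdiff_subset⟩, hdis, ?_⟩
      obtain ⟨u, rfl⟩ := Finset.card_eq_one.1 hYc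
      rw [if_pos (hT hnT)] at hle ⊢
      have hu : u ∈ U \ Finset.univ.biUnion X := by
        refine Finset.mem_sdiff.2 ⟨hYU (Finset.mem_singleton_self u), fun hu => ?_⟩
        obtain ⟨j, -, hj⟩ := Finset.mem_biUnion.1 hu
        exact Finset.disjoint_left.1 (hXY j) (Finset.mem_singleton_self u) hj
      have h₀ : (U \ {u}) \ Finset.univ.biUnion X = (U \ Finset.univ.biUnion X).erase u := by
        ext a
        simp only [Finset.mem_sdiff, Finset.mem_erase, Finset.mem_singleton]
        tauto
      rw [h₀] at hle
      rw [← Finset.add_sum_erase _ _ hu]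
      have h₁ := surplus_mono (F := F) (x := x) (κ := κ) (X := {u}) hT
      have h₂ := le_max_right 0 (surplus F x κ S {u})
      rw [h]
      linarith

end Demand

end MultiDigraph

/-! ### Sufficiency -/

namespace MultiDigraph

variable {W A : Type*} [Fintype W] [DecidableEq W] [Fintype A] [DecidableEq A]
  {D : MultiDigraph W A} {k : ℕ} {x : W} {F : Fin k → D.Sub}

section Sufficiency

variable {Λ : Type*} [Fintype Λ] [DecidableEq Λ]

theorem sum_finset_option (f : Option Λ → ℤ) (S : Finset (Option Λ)) :
    ∑ o ∈ S, f o = (if none ∈ S then f none else 0) + ∑ α ∈ Finset.eraseNone S, f (some α) := by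
  have h₁ : ∑ o ∈ S, f o = ∑ o, if o ∈ S then f o else 0 := by
    rw [← Finset.sum_filter]; simp
  have h₂ : ∑ α ∈ Finset.eraseNone S, f (some α) = ∑ α, if some α ∈ S then f (some α) else 0 := by
    rw [← Finset.sum_filter]
    congr 1
    ext α; simp
  rw [h₁, h₂, Fintype.sum_option]

theorem indicesOf_some_comp (κ : Fin k → Λ) (S : Finset (Option Λ)) :
    indicesOf (some ∘ κ) S = indicesOf κ (Finset.eraseNone S) := by
  ext i; simp [mem_indicesOf]

theorem exists_extension_of_subpartition_bounds (κ : Fin k → Λ)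
    (hF : ∀ i, (F i).IsArborescence x) (hd : ArcDisjoint F) (lo hi : Λ → ℤ)
    (hlohi : ∀ α, lo α ≤ hi α) (hhi : ∀ α, 0 ≤ hi α)
    (hupper : ∀ (t : ℕ) (X : Fin t → Finset W) (S : Finset Λ),
      (∀ j, (X j).Nonempty ∧ x ∉ X j) → (∀ j j', j ≠ j' → Disjoint (X j) (X j')) →
      ∑ j, (((missing F (indicesOf κ S) (X j)).card : ℤ) - D.inDeg (innerArcs F x) (X j)) ≤
        ∑ α ∈ S, hi α)
    (hlower : ∀ (t : ℕ) (X : Fin t → Finset W) (S : Finset Λ),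
      (∀ j, (X j).Nonempty ∧ x ∉ X j) → (∀ j j', j ≠ j' → Disjoint (X j) (X j')) →
      ∑ j, ((missing F (indicesOf κ S) (X j)).card : ℤ) + ∑ α ∈ Sᶜ, lo α -
          ∑ u ∈ (Finset.univ.erase x) \ Finset.univ.biUnion X,
            ((min (missing F (indicesOf κ Sᶜ) {u}).card
              (D.numArcs (freeArcs F) {x} {u}) : ℕ) : ℤ) ≤
        ∑ j, (D.inDeg (freeArcs F) (X j) : ℤ)) :
    ∃ F' : Fin k → D.Sub, (∀ i, (F i).IsSubOf (F' i)) ∧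
      (∀ i, (F' i).IsArborescence x ∧ (F' i).IsSpanning) ∧ ArcDisjoint F' ∧
      ∀ α, lo α ≤ ∑ i with κ i = α, (D.outDeg (F' i).arcs x : ℤ) -
          ∑ i with κ i = α, (D.outDeg (F i).arcs x : ℤ) ∧
        ∑ i with κ i = α, (D.outDeg (F' i).arcs x : ℤ) -
          ∑ i with κ i = α, (D.outDeg (F i).arcs x : ℤ) ≤ hi α := by
  set G : Finset W := Finset.univ.erase x with hG
  set n : W → ℕ := fun u => D.numArcs (freeArcs F) {x} {u} with hn
  set N : ℤ := ∑ u ∈ G, (n u : ℤ) with hN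
  have hxG : ∀ {X : Finset W}, X ⊆ G → x ∉ X := fun h hx => by simpa [hG] using h hx
  have hcompl : ∀ S : Finset (Option Λ), Finset.eraseNone Sᶜ = (Finset.eraseNone S)ᶜ := by
    intro S; ext α; simp
  have hp := demand_bisupermodular (F := F) (x := x) (κ := κ)
  -- the two families of inequalities, in terms of packings
  have hlo : ∀ S v, PackingValue (demand F x κ) S G v →
      v + ∑ o ∈ Sᶜ, (o.elim 0 lo : ℤ) ≤ N := by
    intro S v hv
    -- Adjoining `none` to `S` is free, since its lower bound is zero.
    obtain ⟨t, X, hX, hdis, hle⟩ :=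
      exists_subpartition (hv.mono (Finset.subset_insert none S) subset_rfl)
    rw [if_pos (Finset.mem_insert_self _ _)] at hle
    have h₁ := hlower t X (Finset.eraseNone S) (fun j => ⟨(hX j).1, hxG (hX j).2⟩) hdis
    have h₂ : Finset.eraseNone (insert none S) = Finset.eraseNone S := by ext α; simp
    have h₃ : ∑ o ∈ Sᶜ, (o.elim 0 lo : ℤ) = ∑ α ∈ (Finset.eraseNone S)ᶜ, lo α := by
      rw [sum_finset_option, hcompl]; simp
    have h₄ : ∀ j, (D.inDeg (freeArcs F) (X j) : ℤ) =
        D.inDeg (innerArcs F x) (X j) + ∑ u ∈ X j, (n u : ℤ) := fun j => by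
      rw [inDeg_freeArcs (hxG (hX j).2)]; push_cast; rfl
    have h₅ : N = ∑ j, ∑ u ∈ X j, (n u : ℤ) + ∑ u ∈ G \ Finset.univ.biUnion X, (n u : ℤ) := by
      rw [hN, ← Finset.sum_biUnion fun j _ j' _ h => hdis j j' h, add_comm]
      exact (Finset.sum_sdiff (Finset.biUnion_subset.2 fun j _ => (hX j).2)).symm
    have h₆ : ∀ u, max 0 (surplus F x κ (insert none S) {u}) = (n u : ℤ) -
        ((min (missing F (indicesOf κ (Finset.eraseNone S)ᶜ) {u}).card (n u) : ℕ) : ℤ) := by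
      intro u
      rw [surplus, indicesOf_some_comp, hcompl, h₂, Finset.sum_singleton]
      push_cast
      change max 0 ((n u : ℤ) - _) = _
      omega
    simp only [h₆, Finset.sum_sub_distrib, deficit, indicesOf_some_comp, h₂] at hle
    rw [Finset.sum_congr rfl fun j _ => h₄ j, Finset.sum_add_distrib] at h₁
    rw [h₃, h₅]
    change _ + _ - ∑ u ∈ G \ Finset.univ.biUnion X,
      ((min (missing F (indicesOf κ (Finset.eraseNone S)ᶜ) {u}).card (n u) : ℕ) : ℤ) ≤ _ at h₁
    linarith
  have hhi' : ∀ S v, PackingValue (demand F x κ) S G v → v ≤ ∑ o ∈ S, (o.elim N hi : ℤ) := by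
    intro S v hv
    rw [sum_finset_option]
    -- The upper bound `N` on row `none` is large enough to make these sets unrestrictive; (ii) is
    -- needed only for the others.
    by_cases hS : none ∈ S
    · rw [if_pos hS]
      have h₁ := hlo _ _ (hv.mono (Finset.subset_univ S) subset_rfl)
      have h₂ : 0 ≤ ∑ α ∈ Finset.eraseNone S, hi α := Finset.sum_nonneg fun α _ => hhi α
      simp only [Finset.compl_univ, Finset.sum_empty, add_zero, Option.elim] at h₁ ⊢
      linarith
    · obtain ⟨t, X, hX, hdis, hle⟩ := exists_subpartition hv
      have h₁ := hupper t X (Finset.eraseNone S) (fun j => ⟨(hX j).1, hxG (hX j).2⟩) hdis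
      rw [if_neg hS] at hle ⊢
      simp only [deficit, indicesOf_some_comp] at hle
      simp only [Option.elim]
      linarith
  have hN0 : 0 ≤ N := Finset.sum_nonneg fun u _ => Int.natCast_nonneg _
  have hsum0 : 0 ≤ ∑ α, hi α := Finset.sum_nonneg fun α _ => hhi α
  obtain ⟨a, ha₁, ha₂, ha₃⟩ := exists_vector_in_box hp G (fun o => o.elim 0 lo) N
    (∑ α, hi α).toNat (fun o => o.elim N hi) (Option.rec hN0 hlohi)
    (by rw [Fintype.sum_option, Int.toNat_of_nonneg hsum0]; rfl) hhi' hlo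
  -- No index lies outside the full label set, so the surplus there is all of `n v`, as the column
  -- condition requires.
  obtain ⟨m, hm₁, hm₂, hm₃⟩ := exists_covering_matrix G (∑ u ∈ G, n u) _ hp a n ha₃
    (fun v hv => by
      refine le_trans (le_of_eq ?_)
        (surplus_le_demand (Finset.mem_univ none) (Finset.card_singleton v))
      simp [surplus, hn, missing, indicesOf])
    ha₂ rfl
  have hroot := exists_root_extension κ _ F (fun α u => m (some α) u) hF hd ?_ ?_ ?_ rfl
  · obtain ⟨F₁, hsub₁, hF₁, hd₁, hcov₁, hout₁⟩ := hroot
    obtain ⟨F', hsub', hF', hd', hout'⟩ := exists_spanning_extension _ F₁ hF₁ hd₁ hcov₁ rfl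
    refine ⟨F', fun i => ⟨(hsub₁ i).1.trans (hsub' i).1, (hsub₁ i).2.trans (hsub' i).2⟩, hF', hd',
      fun α => ?_⟩
    have h₁ : ∑ i with κ i = α, (D.outDeg (F' i).arcs x : ℤ) =
        ∑ i with κ i = α, (D.outDeg (F i).arcs x : ℤ) + a (some α) := by
      rw [← hm₁]
      simp only [hout']
      exact_mod_cast hout₁ α
    have h₂ := ha₁ (some α)
    simp only [Option.elim] at h₂
    constructor <;> linarith
  · intro S X hX hxX
    have h₁ := hm₃ (S.map Function.Embedding.some) X
      (fun u hu => Finset.mem_erase.2 ⟨fun h => hxX (h ▸ hu), Finset.mem_univ _⟩) hX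
    have h₂ := deficit_le_demand (F := F) (x := x) (κ := κ) (S := S.map Function.Embedding.some)
      (X := X)
    have h₃ : Finset.eraseNone (S.map Function.Embedding.some) = S := by ext α; simp
    rw [deficit, indicesOf_some_comp, h₃] at h₂
    rw [Finset.sum_map] at h₁
    have h₄ : ((missing F (indicesOf κ S) X).card : ℤ) ≤
        D.inDeg (innerArcs F x) X + ∑ β ∈ S, ∑ v ∈ X, (m (some β) v : ℤ) := by
      simp only [Function.Embedding.some_apply] at h₁
      linarith
    exact_mod_cast h₄
  · intro α u hux
    have huG : u ∈ G := Finset.mem_erase.2 ⟨hux, Finset.mem_univ _⟩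
    -- Taking all labels but `α`, the surplus bounds the rest of column `u` from below; as the
    -- column sums to `n u`, this bounds `m (some α) u` from above.
    have h₁ := hm₃ (Finset.univ.erase (some α)) {u} (Finset.singleton_subset_iff.2 huG)
      (Finset.singleton_nonempty u)
    have h₂ := surplus_le_demand (F := F) (x := x) (κ := κ) (S := Finset.univ.erase (some α))
      (by simp) (Finset.card_singleton u)
    have h₃ : Finset.eraseNone (Finset.univ.erase (some α))ᶜ = {α} := by
      ext β; simp
    rw [surplus, indicesOf_some_comp, h₃, Finset.sum_singleton] at h₂
    have h₄ := Finset.add_sum_erase Finset.univ (fun o => (m o u : ℤ)) (Finset.mem_univ (some α))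
    have h₅ : ∑ o, (m o u : ℤ) = n u := by exact_mod_cast hm₂ u huG
    simp only [Finset.sum_singleton] at h₁
    have h₆ : (D.numArcs (freeArcs F) {x} {u} : ℤ) = n u := rfl
    have h₇ : (m (some α) u : ℤ) ≤ (missing F (indicesOf κ {α}) {u}).card := by linarith
    exact_mod_cast h₇
  · intro u hux
    have h₁ := hm₂ u (Finset.mem_erase.2 ⟨hux, Finset.mem_univ _⟩)
    rw [Fintype.sum_option] at h₁
    change _ ≤ n u
    omega

end Sufficiency

end MultiDigraph

/-! ### Necessity -/

namespace MultiDigraph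

variable {W A : Type*} [Fintype W] [DecidableEq W] [Fintype A] [DecidableEq A]
  {D : MultiDigraph W A} {k : ℕ} {x : W} {F F' : Fin k → D.Sub}

section Necessity

theorem sum_card_filter_le {N : Fin k → Finset A} (hN : ∀ i j, i ≠ j → Disjoint (N i) (N j))
    (P : A → Prop) [DecidablePred P] (B : Finset A) (h : ∀ i, ∀ a ∈ N i, P a → a ∈ B)
    (I : Finset (Fin k)) : ∑ i ∈ I, ((N i).filter P).card ≤ (B.filter P).card := by
  rw [← Finset.card_biUnion fun i _ j _ hij =>
    Finset.disjoint_filter_filter (hN i j hij)]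
  refine Finset.card_le_card fun a ha => ?_
  obtain ⟨i, -, hi⟩ := Finset.mem_biUnion.1 ha
  rw [Finset.mem_filter] at hi ⊢
  exact ⟨h i a hi.1 hi.2, hi.2⟩

theorem sdiff_arcs_subset_freeArcs (hsub : ∀ i, (F i).IsSubOf (F' i)) (hd' : ArcDisjoint F')
    (i : Fin k) : (F' i).arcs \ (F i).arcs ⊆ freeArcs F := by
  intro a ha
  rw [Finset.mem_sdiff] at ha
  refine mem_freeArcs.2 fun j hj => ?_
  by_cases hij : i = j
  · exact ha.2 (hij ▸ hj)
  · exact Finset.disjoint_left.1 (hd' i j hij) ha.1 ((hsub j).2 hj)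

theorem exists_new_entering (hF' : ∀ i, (F' i).IsArborescence x ∧ (F' i).IsSpanning) {i : Fin k}
    {X : Finset W} (hX : X.Nonempty) (hxX : x ∉ X) (hdis : Disjoint X (F i).verts) :
    ∃ a ∈ (F' i).arcs \ (F i).arcs, D.tail a ∉ X ∧ D.head a ∈ X := by
  obtain ⟨v, hv⟩ := hX
  obtain ⟨p, hp, -⟩ := (hF' i).1.2.2 v ((hF' i).2 v)
  obtain ⟨a, ha, hta, hha⟩ := hp.1.exists_entering hxX hv
  exact ⟨a, Finset.mem_sdiff.2 ⟨hp.2.1 a ha, fun h =>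
    Finset.disjoint_left.1 hdis hha ((F i).head_mem a h)⟩, hta, hha⟩

/-- Every index of `I` missing `X` supplies a new arc entering `X`, and new root arcs of the other
indices with head in `X` also enter it, because `x ∉ X`. Arc-disjointness keeps all of these
distinct. -/
theorem card_missing_add_le (hsub : ∀ i, (F i).IsSubOf (F' i)) (hd' : ArcDisjoint F')
    (hF' : ∀ i, (F' i).IsArborescence x ∧ (F' i).IsSpanning) {X : Finset W} (hX : X.Nonempty)
    (hxX : x ∉ X) (I : Finset (Fin k)) :
    (missing F I X).card + ∑ i ∈ Iᶜ, (((F' i).arcs \ (F i).arcs).filter fun a =>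
      D.tail a = x ∧ D.head a ∈ X).card ≤ D.inDeg (freeArcs F) X := by
  have hN : ∀ i j, i ≠ j → Disjoint ((F' i).arcs \ (F i).arcs) ((F' j).arcs \ (F j).arcs) :=
    fun i j hij => (hd' i j hij).mono Finset.sdiff_subset Finset.sdiff_subset
  refine le_trans ?_ (sum_card_filter_le hN (fun a => D.tail a ∈ Xᶜ ∧ D.head a ∈ X) (freeArcs F)
    (fun i a ha _ => sdiff_arcs_subset_freeArcs hsub hd' i ha) Finset.univ)
  rw [← Finset.sum_add_sum_compl I]
  refine add_le_add ?_ (Finset.sum_le_sum fun i _ => Finset.card_le_card fun a ha => ?_)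
  · rw [missing, Finset.card_filter]
    refine Finset.sum_le_sum fun i _ => ?_
    split_ifs with hdis
    · obtain ⟨a, ha, hta, hha⟩ := exists_new_entering hF' hX hxX hdis
      exact Finset.card_pos.2 ⟨a, by
        rw [Finset.mem_filter, Finset.mem_compl]; exact ⟨ha, hta, hha⟩⟩
    · exact Nat.zero_le _
  · rw [Finset.mem_filter] at ha ⊢
    exact ⟨ha.1, Finset.mem_compl.2 (ha.2.1 ▸ hxX), ha.2.2⟩

/-- The new arc entering `X` is either an inner arc or a root arc, and only root arcs of indices in
`I` are charged. -/
theorem card_missing_le (hsub : ∀ i, (F i).IsSubOf (F' i)) (hd' : ArcDisjoint F')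
    (hF' : ∀ i, (F' i).IsArborescence x ∧ (F' i).IsSpanning) {X : Finset W} (hX : X.Nonempty)
    (hxX : x ∉ X) (I : Finset (Fin k)) :
    (missing F I X).card ≤ D.inDeg (innerArcs F x) X +
      ∑ i ∈ I, (((F' i).arcs \ (F i).arcs).filter fun a =>
        D.tail a = x ∧ D.head a ∈ X).card := by
  have hN : ∀ i j, i ≠ j →
      Disjoint (((F' i).arcs \ (F i).arcs).filter fun a => D.tail a ≠ x)
        (((F' j).arcs \ (F j).arcs).filter fun a => D.tail a ≠ x) :=
    fun i j hij => ((hd' i j hij).mono Finset.sdiff_subset Finset.sdiff_subset).mono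
      (Finset.filter_subset _ _) (Finset.filter_subset _ _)
  have h₁ := sum_card_filter_le hN (fun a => D.tail a ∈ Xᶜ ∧ D.head a ∈ X) (innerArcs F x)
    (fun i a ha _ => by
      rw [Finset.mem_filter] at ha
      exact mem_innerArcs.2 ⟨sdiff_arcs_subset_freeArcs hsub hd' i ha.1, ha.2⟩) I
  refine le_trans ?_ (Nat.add_le_add_right h₁ _)
  rw [← Finset.sum_add_distrib, missing, Finset.card_filter]
  refine Finset.sum_le_sum fun i _ => ?_
  split_ifs with hdis
  · obtain ⟨a, ha, hta, hha⟩ := exists_new_entering hF' hX hxX hdis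
    by_cases hax : D.tail a = x
    · exact Nat.le_add_left_of_le (Finset.card_pos.2 ⟨a, Finset.mem_filter.2 ⟨ha, hax, hha⟩⟩)
    · refine Nat.le_add_right_of_le (Finset.card_pos.2 ⟨a, ?_⟩)
      rw [Finset.mem_filter, Finset.mem_filter, Finset.mem_compl]
      exact ⟨⟨ha, hax⟩, hta, hha⟩
  · exact Nat.zero_le _

theorem outDeg_eq_add (hsub : ∀ i, (F i).IsSubOf (F' i)) (i : Fin k) :
    D.outDeg (F' i).arcs x = D.outDeg (F i).arcs x +
      (((F' i).arcs \ (F i).arcs).filter fun a => D.tail a = x).card := by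
  have h : ∀ B : Finset A, D.outDeg B x = (B.filter fun a => D.tail a = x).card := by
    intro B
    rw [outDeg, numArcs]
    congr 1
    ext a
    simp only [Finset.mem_filter, Finset.mem_singleton, Finset.mem_compl, and_congr_right_iff,
      and_iff_left_iff_imp]
    exact fun _ h h' => D.tail_ne_head a (h.trans h'.symm)
  rw [h, h, ← Finset.card_union_of_disjoint
    (Finset.disjoint_filter_filter Finset.disjoint_sdiff), ← Finset.filter_union,
    Finset.union_sdiff_of_subset (hsub i).2]

/-- Splitting the arcs of `B` at the root according to their heads. -/
theorem card_root_arcs_eq (B : Finset A) {t : ℕ} {X : Fin t → Finset W}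
    (hX : ∀ j, (X j).Nonempty ∧ x ∉ X j) (hdis : ∀ j j', j ≠ j' → Disjoint (X j) (X j')) :
    (B.filter fun a => D.tail a = x).card =
      ∑ j, (B.filter fun a => D.tail a = x ∧ D.head a ∈ X j).card +
        ∑ u ∈ Finset.univ.erase x \ Finset.univ.biUnion X,
          (B.filter fun a => D.tail a = x ∧ D.head a = u).card := by
  have h : ∀ Y : Finset W, (B.filter fun a => D.tail a = x ∧ D.head a ∈ Y).card =
      ∑ u ∈ Y, (B.filter fun a => D.tail a = x ∧ D.head a = u).card := by
    intro Y
    rw [Finset.card_eq_sum_card_fiberwise (f := D.head) (t := Y)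
      (fun a ha => (Finset.mem_filter.1 ha).2.2)]
    refine Finset.sum_congr rfl fun u hu => ?_
    rw [Finset.filter_filter]
    congr 1
    ext a
    simp only [Finset.mem_filter]
    constructor
    · rintro ⟨h, ⟨h', -⟩, h''⟩; exact ⟨h, h', h''⟩
    · rintro ⟨h, h', rfl⟩; exact ⟨h, ⟨h', hu⟩, rfl⟩
  have hsubset : Finset.univ.biUnion X ⊆ Finset.univ.erase x :=
    Finset.biUnion_subset.2 fun j _ v hv =>
      Finset.mem_erase.2 ⟨fun h => (hX j).2 (h ▸ hv), Finset.mem_univ _⟩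
  simp only [h]
  rw [← Finset.sum_biUnion fun j _ j' _ hjj' => hdis j j' hjj', add_comm,
    Finset.sum_sdiff hsubset, ← h]
  congr 1
  ext a
  simp only [Finset.mem_filter, Finset.mem_erase, Finset.mem_univ, and_true, and_congr_right_iff]
  exact fun _ => ⟨fun h' => ⟨h', fun h'' => D.tail_ne_head a (h'.trans h''.symm)⟩, fun h => h.1⟩

/-- A tree has no parallel arcs, so each index adds at most one arc from `x` to `u`, and none if `u`
is already in its `F i`, by uniqueness of paths. -/
theorem sum_card_root_arcs_le (hsub : ∀ i, (F i).IsSubOf (F' i)) (hF : ∀ i, (F i).IsArborescence x)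
    (hF' : ∀ i, (F' i).IsArborescence x ∧ (F' i).IsSpanning) (hd' : ArcDisjoint F')
    (I : Finset (Fin k)) (u : W) :
    ∑ i ∈ I, (((F' i).arcs \ (F i).arcs).filter fun a => D.tail a = x ∧ D.head a = u).card ≤
      min (missing F I {u}).card (D.numArcs (freeArcs F) {x} {u}) := by
  have hN : ∀ i j, i ≠ j → Disjoint ((F' i).arcs \ (F i).arcs) ((F' j).arcs \ (F j).arcs) :=
    fun i j hij => (hd' i j hij).mono Finset.sdiff_subset Finset.sdiff_subset
  refine le_min ?_ ?_
  · rw [missing, Finset.card_filter]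
    refine Finset.sum_le_sum fun i _ => ?_
    split_ifs with hdis
    · rw [Finset.card_le_one]
      intro a ha b hb
      rw [Finset.mem_filter, Finset.mem_sdiff] at ha hb
      refine (hF' i).1.2.1.1 a ha.1.1 b hb.1.1 ?_
      rw [ha.2.1, ha.2.2, hb.2.1, hb.2.2]
    · rw [Nat.le_zero, Finset.card_eq_zero, Finset.filter_eq_empty_iff]
      rintro a ha ⟨hta, hha⟩
      rw [Finset.mem_sdiff] at ha
      refine hdis (Finset.disjoint_singleton_left.2 ?_)
      exact hha ▸ (hF i).head_notMem (hF' i).1 (hsub i) ha.1 ha.2 hta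
  · refine (sum_card_filter_le hN (fun a => D.tail a = x ∧ D.head a = u) (freeArcs F)
      (fun i a ha _ => sdiff_arcs_subset_freeArcs hsub hd' i ha) I).trans (le_of_eq ?_)
    simp only [numArcs, Finset.mem_singleton]

theorem sum_card_missing_add_le (hsub : ∀ i, (F i).IsSubOf (F' i))
    (hF : ∀ i, (F i).IsArborescence x)
    (hF' : ∀ i, (F' i).IsArborescence x ∧ (F' i).IsSpanning) (hd' : ArcDisjoint F') {t : ℕ}
    {X : Fin t → Finset W} (hX : ∀ j, (X j).Nonempty ∧ x ∉ X j)
    (hdis : ∀ j j', j ≠ j' → Disjoint (X j) (X j')) (I : Finset (Fin k)) :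
    ∑ j, (missing F I (X j)).card +
        ∑ i ∈ Iᶜ, (((F' i).arcs \ (F i).arcs).filter fun a => D.tail a = x).card ≤
      ∑ j, D.inDeg (freeArcs F) (X j) +
        ∑ u ∈ Finset.univ.erase x \ Finset.univ.biUnion X,
          min (missing F Iᶜ {u}).card (D.numArcs (freeArcs F) {x} {u}) := by
  rw [Finset.sum_congr rfl fun i _ => card_root_arcs_eq _ hX hdis, Finset.sum_add_distrib,
    Finset.sum_comm, Finset.sum_comm (s := Iᶜ), ← add_assoc, ← Finset.sum_add_distrib]
  exact add_le_add
    (Finset.sum_le_sum fun j _ => card_missing_add_le hsub hd' hF' (hX j).1 (hX j).2 I)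
    (Finset.sum_le_sum fun u _ => sum_card_root_arcs_le hsub hF hF' hd' Iᶜ u)

theorem sum_card_missing_le (hsub : ∀ i, (F i).IsSubOf (F' i))
    (hF' : ∀ i, (F' i).IsArborescence x ∧ (F' i).IsSpanning) (hd' : ArcDisjoint F') {t : ℕ}
    {X : Fin t → Finset W} (hX : ∀ j, (X j).Nonempty ∧ x ∉ X j)
    (hdis : ∀ j j', j ≠ j' → Disjoint (X j) (X j')) (I : Finset (Fin k)) :
    ∑ j, (missing F I (X j)).card ≤ ∑ j, D.inDeg (innerArcs F x) (X j) +
      ∑ i ∈ I, (((F' i).arcs \ (F i).arcs).filter fun a => D.tail a = x).card := by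
  refine (Finset.sum_le_sum fun j _ =>
    card_missing_le hsub hd' hF' (hX j).1 (hX j).2 I).trans ?_
  rw [Finset.sum_add_distrib, Finset.sum_comm]
  refine Nat.add_le_add_left (Finset.sum_le_sum fun i _ => ?_) _
  rw [card_root_arcs_eq _ hX hdis]
  exact Nat.le_add_right _ _

end Necessity

theorem weight_eq (F : Fin k → D.Sub) (x : W) (I : Finset (Fin k)) (u : W) :
    weight F x I u = min (missing F I {u}).card (D.numArcs (freeArcs F) {x} {u}) := by
  have h₁ : (I.filter fun i => u ∉ (F i).verts) = missing F I {u} := by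
    simp only [missing, Finset.disjoint_singleton_left]
  rw [weight, h₁]
  split_ifs with h
  · rfl
  · have : D.numArcs (freeArcs F) {x} {u} = 0 := by
      rw [numArcs, Finset.card_eq_zero, Finset.filter_eq_empty_iff]
      rintro a - ⟨ht, hh⟩
      rw [Finset.mem_singleton] at ht hh
      exact h (Finset.mem_image.2 ⟨a, by simp [outArcs, ht], hh⟩)
    rw [this, Nat.min_zero]

end MultiDigraph

/-! ### The theorem -/

theorem theorem1p10 {W A : Type*} [Fintype W] [DecidableEq W] [Fintype A] [DecidableEq A]
    -- the digraph `D = (V + x, A)`, where `V + x` is the type `W`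
    (D : MultiDigraph W A) (x : W) (k : ℕ) (hk : 0 < k)
    -- the partition `I_1, …, I_l` of `[k]`
    (l : ℕ) (part : Fin l → Finset (Fin k))
    (hpart_nonempty : ∀ α, (part α).Nonempty)
    (hpart_disjoint : ∀ α β, α ≠ β → Disjoint (part α) (part β))
    (hpart_cover : ∀ i : Fin k, ∃ α, i ∈ part α)
    -- the lower bounds `c` and the upper bounds `c'`
    (c c' : Fin l → ℕ) (hcc' : ∀ α, c α ≤ c' α)
    -- the arc-disjoint `x`-arborescences `F_1, …, F_k`
    (F : Fin k → D.Sub) (hF : ∀ i, (F i).IsArborescence x)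
    (hF_disjoint : MultiDigraph.ArcDisjoint F)
    (hF_deg : ∀ α, ∑ i ∈ part α, D.outDeg (F i).arcs x ≤ c' α) :
    (∃ F' : Fin k → D.Sub,
        (∀ i, (F i).IsSubOf (F' i)) ∧
        (∀ i, (F' i).IsArborescence x ∧ (F' i).IsSpanning) ∧
        MultiDigraph.ArcDisjoint F' ∧
        ∀ α, c α ≤ ∑ i ∈ part α, D.outDeg (F' i).arcs x ∧
          ∑ i ∈ part α, D.outDeg (F' i).arcs x ≤ c' α) ↔
      -- for all disjoint nonempty `X_1, …, X_t ⊆ V` and every union `I` of some of the parts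
      ∀ (t : ℕ) (X : Fin t → Finset W) (I : Finset (Fin k)),
        (∀ j, (X j).Nonempty ∧ x ∉ X j) →
        (∀ j j', j ≠ j' → Disjoint (X j) (X j')) →
        (∃ S : Finset (Fin l), I = S.biUnion part) →
        ((∑ j, (D.inDeg (MultiDigraph.freeArcs F) (X j) : ℤ) ≥
            ∑ j, ((MultiDigraph.missing F I (X j)).card : ℤ)
              + ∑ α with part α ⊆ Iᶜ,
                  ((c α : ℤ) - ∑ i ∈ part α, (D.outDeg (F i).arcs x : ℤ))
              - ∑ u ∈ (Finset.univ.erase x) \ Finset.univ.biUnion X,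
                  (MultiDigraph.weight F x Iᶜ u : ℤ)) ∧
          (∑ j, (((MultiDigraph.missing F I (X j)).card : ℤ)
                - D.inDeg (MultiDigraph.freeArcs F \ D.outArcs Finset.univ x) (X j)) ≤
            ∑ α with part α ⊆ I,
              ((c' α : ℤ) - ∑ i ∈ part α, (D.outDeg (F i).arcs x : ℤ)))) := by
  classical
  -- The partition becomes a labelling of the indices, and unions of parts become preimages of label
  -- sets.
  choose κ hκ using hpart_cover
  have hpart : ∀ α, part α = Finset.univ.filter fun i => κ i = α := by
    intro α
    ext i
    rw [Finset.mem_filter]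
    refine ⟨fun hi => ⟨Finset.mem_univ _, ?_⟩, fun hi => hi.2 ▸ hκ i⟩
    by_contra hne
    exact Finset.disjoint_left.1 (hpart_disjoint _ _ hne) (hκ i) hi
  have hunion : ∀ S : Finset (Fin l), S.biUnion part = MultiDigraph.indicesOf κ S := by
    intro S
    ext i
    simp [hpart, MultiDigraph.mem_indicesOf]
  have hcompl : ∀ S : Finset (Fin l),
      (MultiDigraph.indicesOf κ S)ᶜ = MultiDigraph.indicesOf κ Sᶜ := by
    intro S
    ext i
    simp [MultiDigraph.mem_indicesOf]
  -- Nonemptiness of the parts matters here: an empty part would lie in every union.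
  have hsubset : ∀ S : Finset (Fin l),
      (Finset.univ.filter fun α => part α ⊆ MultiDigraph.indicesOf κ S) = S := by
    intro S
    ext α
    rw [Finset.mem_filter, hpart]
    refine ⟨fun h => ?_, fun h => ⟨Finset.mem_univ _, fun i hi => ?_⟩⟩
    · obtain ⟨i, hi⟩ := hpart_nonempty α
      rw [hpart] at hi
      have := MultiDigraph.mem_indicesOf.1 (h.2 hi)
      rwa [(Finset.mem_filter.1 hi).2] at this
    · rw [MultiDigraph.mem_indicesOf, (Finset.mem_filter.1 hi).2]
      exact h
  have hsum : ∀ (S : Finset (Fin l)) (f : Fin k → ℤ),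
      ∑ i ∈ MultiDigraph.indicesOf κ S, f i = ∑ α ∈ S, ∑ i ∈ part α, f i := by
    intro S f
    rw [← hunion, Finset.sum_biUnion fun α _ β _ h => hpart_disjoint α β h]
  constructor
  · rintro ⟨F', hsub, hF', hd', hdeg⟩ t X I hX hdis ⟨S, rfl⟩
    rw [hunion, hcompl, hsubset, hsubset]
    have hout : ∀ α, ∑ i ∈ part α, (D.outDeg (F' i).arcs x : ℤ) =
        ∑ i ∈ part α, (D.outDeg (F i).arcs x : ℤ) + ∑ i ∈ part α,
          ((((F' i).arcs \ (F i).arcs).filter fun a => D.tail a = x).card : ℤ) := by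
      intro α
      rw [← Finset.sum_add_distrib]
      refine Finset.sum_congr rfl fun i _ => ?_
      exact_mod_cast MultiDigraph.outDeg_eq_add (x := x) hsub i
    have hlow : ∀ α, (c α : ℤ) ≤ ∑ i ∈ part α, (D.outDeg (F' i).arcs x : ℤ) := fun α => by
      exact_mod_cast (hdeg α).1
    have hupp : ∀ α, ∑ i ∈ part α, (D.outDeg (F' i).arcs x : ℤ) ≤ c' α := fun α => by
      exact_mod_cast (hdeg α).2
    constructor
    · have h₁ := MultiDigraph.sum_card_missing_add_le hsub hF hF' hd' hX hdis
        (MultiDigraph.indicesOf κ S)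
      rw [hcompl] at h₁
      zify at h₁
      rw [hsum] at h₁
      have h₂ : ∑ α ∈ Sᶜ, ((c α : ℤ) - ∑ i ∈ part α, (D.outDeg (F i).arcs x : ℤ)) ≤
          ∑ α ∈ Sᶜ, ∑ i ∈ part α,
            ((((F' i).arcs \ (F i).arcs).filter fun a => D.tail a = x).card : ℤ) :=
        Finset.sum_le_sum fun α _ => by linarith [hout α, hlow α]
      simp only [MultiDigraph.weight_eq, Nat.cast_min]
      linarith
    · have h₁ := MultiDigraph.sum_card_missing_le hsub hF' hd' hX hdis
        (MultiDigraph.indicesOf κ S)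
      zify at h₁
      rw [hsum] at h₁
      have h₂ : ∑ α ∈ S, ∑ i ∈ part α,
            ((((F' i).arcs \ (F i).arcs).filter fun a => D.tail a = x).card : ℤ) ≤
          ∑ α ∈ S, ((c' α : ℤ) - ∑ i ∈ part α, (D.outDeg (F i).arcs x : ℤ)) :=
        Finset.sum_le_sum fun α _ => by linarith [hout α, hupp α]
      rw [Finset.sum_sub_distrib]
      change _ - ∑ j, (D.inDeg (MultiDigraph.innerArcs F x) (X j) : ℤ) ≤ _
      linarith
  · intro h
    obtain ⟨F', hsub, hF', hd', hdeg⟩ :=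
      MultiDigraph.exists_extension_of_subpartition_bounds κ hF hF_disjoint
        (fun α => (c α : ℤ) - ∑ i ∈ part α, (D.outDeg (F i).arcs x : ℤ))
        (fun α => (c' α : ℤ) - ∑ i ∈ part α, (D.outDeg (F i).arcs x : ℤ))
        (fun α => sub_le_sub_right (by exact_mod_cast hcc' α) _)
        (fun α => sub_nonneg.2 (by exact_mod_cast hF_deg α))
        (fun t X S hX hdis => by
          have := (h t X (S.biUnion part) hX hdis ⟨S, rfl⟩).2
          rw [hunion, hsubset] at this
          exact this)
        (fun t X S hX hdis => by
          have := (h t X (S.biUnion part) hX hdis ⟨S, rfl⟩).1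
          rw [hunion, hcompl, hsubset] at this
          simp only [MultiDigraph.weight_eq] at this
          exact this)
    refine ⟨F', hsub, hF', hd', fun α => ?_⟩
    have h₁ := hdeg α
    simp only [← hpart] at h₁
    zify
    constructor <;> linarith
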